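/- Setting. Let $\mathcal Z$ be a measurable space, $\nu,\rho$ measures on $\mathcal Z$ (for instance counting measure on a countable set, or Lebesgue measure on a subset of $\mathbb R^k$) and $X:\mathcal Z\to\mathbb R$ measurable. A (regular, single-parameter) exponential family with sufficient statistic $X$, reference measure $\nu$ and measurable carrier $h:\mathcal Z\to[0,\infty)$ consists of the distributions with $\nu$-densities $e^{-\eta X(z)}h(z)/Z(\eta)$, $Z(\eta)=\int e^{-\eta X}h\,d\nu$, for $\eta\in\Theta_{\rm nat}=\{\eta\in\mathbb R: Z(\eta)<\infty\}$, where $\Theta_{\rm nat}$ is a nonempty open interval and $X$ is not $h\,d\nu$-almost everywhere constant. It is parameterized by the mean $\mu=E[X]\in\Theta_{\rm mean}$; write $\mathcal M=\{M_\mu\mid\mu\in\Theta_{\rm mean}\}$ and let $M_\mu(z)$ also denote the density. A plug-in model $U$ with respect to $\mathcal M$ is given by a constant $\bar\mu_0\in\Theta_{\rm mean}$ and measurable estimators $\bar\mu_i=\bar\mu_i(z_1,\dots,z_i)\in\Theta_{\rm mean}$, $i\ge1$; its codelength is $L_U(z^n)=\sum_{i=0}^{n-1}-\ln M_{\bar\mu_i}(z_{i+1})$.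 For outcomes $Z_1,Z_2,\dots$ i.i.d. $\sim P$, its relative redundancy is $$\mathcal R_U(n)=E_P[L_U(Z^n)]-\inf_{\mu\in\Theta_{\rm mean}}E_P[-\ln M_\mu(Z^n)],\qquad M_\mu(Z^n)=\prod_{i=1}^n M_\mu(Z_i).$$ Expectations take values in $[-\infty,+\infty]$, with value $+\infty$ whenever the positive part has infinite expectation. Condition 1 for $\mathcal M$ (with reference measure $\nu$): there is an exponential family $\mathcal P=\{P_\mu\mid\mu\in\Theta_{\rm mean}\}$ with reference measure $\rho$ (possibly equal to $\nu$), the same sufficient statistic $X$ and the same mean-value parameter space $\Theta_{\rm mean}$ such that ${\rm var}_{P_\mu}X>{\rm var}_{M_\mu}X$ for every $\mu\in\Theta_{\rm mean}$, and such that $E_{P_\mu}[-\ln M_\mu(Z)]$ is finite for every $\mu\in\Theta_{\rm mean}$. Statement. Suppose that $\mathcal M$ satisfies Condition 1, and let $U$ be any plug-in model with respect to $\mathcal M$. Then there is a family $\mathcal P=\{P_\mu\mid\mu\in\Theta_{\rm mean}\}$ as in Condition 1 such that for Lebesgue almost all $\mu^*\in\Theta_{\rm mean}$, when the outcomes are i.i.d.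 $\sim P_{\mu^*}$, $$\liminf_{n\to\infty}\frac{\mathcal R_U(n)}{\ln n}\;\ge\;\frac12\,\frac{{\rm var}_{P_{\mu^*}}X}{{\rm var}_{M_{\mu^*}}X}\;>\;\frac12 .$$ Moreover, the set of $\mu^*\in\Theta_{\rm mean}$ for which there is a constant $C$ with $\mathcal R_U(n)\le\frac12\ln n+C$ for all sufficiently large $n$, and hence the set of those for which $\mathcal R_U(n)=\frac12\ln n+O(1)$, has Lebesgue measure zero. -/

import Mathlib

open MeasureTheory ProbabilityTheory Filter Topology
open scoped ENNReal NNReal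

noncomputable section

/-- The partition function `η ↦ ∫ exp (-η X(z)) h(z) dν(z)`, with values in `[0, ∞]`. -/
def partitionFn {Z : Type*} [MeasurableSpace Z] (ν : Measure Z) (X : Z → ℝ) (h : Z → ℝ≥0)
    (η : ℝ) : ℝ≥0∞ :=
  ∫⁻ z, ENNReal.ofReal (Real.exp (-η * X z)) * (h z : ℝ≥0∞) ∂ν

/-- The natural parameter space: all `η` whose partition function is finite. -/
def natSpace {Z : Type*} [MeasurableSpace Z] (ν : Measure Z) (X : Z → ℝ) (h : Z → ℝ≥0) :
    Set ℝ :=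
  {η | partitionFn ν X h η < ∞}

/-- A regular single-parameter exponential family with sufficient statistic `X` and carrier `h`
with respect to the reference measure `ν` (counting measure for a countable outcome space, Lebesgue
measure for a subset of a Euclidean space). By convexity of `η ↦ exp (-η x)`, the natural parameter
space is always an interval, so "regular" amounts to it being open and nonempty. The last field says
that `X` is not almost surely constant; without it the mean would not parameterize the family. -/
structure ExpFamily {Z : Type*} [MeasurableSpace Z] (ν : Measure Z) (X : Z → ℝ) where
  h : Z → ℝ≥0
  measurable_h : Measurable h
  isOpen_natSpace : IsOpen (natSpace ν X h)
  nonempty_natSpace : (natSpace ν X h).Nonempty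
  nondegenerate : ¬ ∃ c : ℝ, ∀ᵐ z ∂(ν.withDensity fun z => (h z : ℝ≥0∞)), X z = c

namespace ExpFamily

variable {Z : Type*} [MeasurableSpace Z] {ν : Measure Z} {X : Z → ℝ}

/-- The density with natural parameter `η`. -/
def natDensity (M : ExpFamily ν X) (η : ℝ) (z : Z) : ℝ≥0∞ :=
  ENNReal.ofReal (Real.exp (-η * X z)) * (M.h z : ℝ≥0∞) / partitionFn ν X M.h η

/-- The expectation of `X` under the member with natural parameter `η`. -/
def natMean (M : ExpFamily ν X) (η : ℝ) : ℝ :=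
  ∫ z, X z ∂(ν.withDensity (M.natDensity η))

/-- The mean-value parameter space. -/
def meanSpace (M : ExpFamily ν X) : Set ℝ :=
  M.natMean '' natSpace ν X M.h

/-- The natural parameter of the member whose mean-value parameter is `μ ∈ M.meanSpace`. -/
def natParam (M : ExpFamily ν X) (μ : ℝ) : ℝ :=
  Function.invFunOn M.natMean (natSpace ν X M.h) μ

/-- The density `M_μ(z)` with mean-value parameter `μ`. -/
def density (M : ExpFamily ν X) (μ : ℝ) (z : Z) : ℝ≥0∞ :=
  M.natDensity (M.natParam μ) z

/-- The distribution `M_μ` with mean-value parameter `μ`. -/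
def dist (M : ExpFamily ν X) (μ : ℝ) : Measure Z :=
  ν.withDensity (M.density μ)

/-- The variance of `X` under `M_μ`. -/
def varX (M : ExpFamily ν X) (μ : ℝ) : ℝ :=
  variance X (M.dist μ)

/-- The codelength `-ln M_μ(z)` in nats; it is `+∞` where the density vanishes. -/
def logLoss (M : ExpFamily ν X) (μ : ℝ) (z : Z) : EReal :=
  -ENNReal.log (M.density μ z)

end ExpFamily

/-- Expectation of an extended-real variable: the integral of the positive part minus the integral
of the negative part. It is `+∞` as soon as the positive part has infinite integral. -/
def expectation {Ω : Type*} [MeasurableSpace Ω] (Q : Measure Ω) (f : Ω → EReal) : EReal :=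
  open Classical in
  if ∫⁻ ω, (f ω).toENNReal ∂Q = ∞ then ⊤
  else ((∫⁻ ω, (f ω).toENNReal ∂Q : ℝ≥0∞) : EReal) - ((∫⁻ ω, (-f ω).toENNReal ∂Q : ℝ≥0∞) : EReal)

/-- The law of `n` independent outcomes with common distribution `Q`. -/
def iidLaw {Z : Type*} [MeasurableSpace Z] (Q : Measure Z) (n : ℕ) : Measure (Fin n → Z) :=
  Measure.pi fun _ => Q

/-- A plug-in model with respect to `M`: a (measurable) estimator of the mean-value parameter for
every sample size, with values in the mean-value parameter space; for `n = 0` it is a constant. Its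
predictive density for the next outcome after `z₁, …, zₙ` is that of the estimated member of `M`. -/
structure PlugInModel {Z : Type*} [MeasurableSpace Z] {ν : Measure Z} {X : Z → ℝ}
    (M : ExpFamily ν X) where
  est : (n : ℕ) → (Fin n → Z) → ℝ
  measurable_est : ∀ n, Measurable (est n)
  est_mem : ∀ n z, est n z ∈ M.meanSpace

namespace PlugInModel

variable {Z : Type*} [MeasurableSpace Z] {ν : Measure Z} {X : Z → ℝ} {M : ExpFamily ν X}

/-- The codelength of the plug-in code: outcome `i` (counted from `0`) is coded with the member of
`M` estimated from the `i` outcomes before it. -/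
def codelength (U : PlugInModel M) (n : ℕ) (z : Fin n → Z) : EReal :=
  ∑ i : Fin n, M.logLoss (U.est i fun j : Fin i => z (Fin.castLE i.isLt.le j)) (z i)

/-- The relative redundancy of the plug-in code after `n` independent outcomes from `Q`: its
expected codelength minus the infimum over `μ` of the expectation of `-ln M_μ(Z₁, …, Zₙ)`. -/
def redundancy (U : PlugInModel M) (Q : Measure Z) (n : ℕ) : EReal :=
  expectation (iidLaw Q n) (U.codelength n) -
    ⨅ μ ∈ M.meanSpace, expectation (iidLaw Q n) fun z => ∑ i, M.logLoss μ (z i)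

end PlugInModel

/-- `P` has the same sufficient statistic and mean-value parameter space as `M`, and strictly larger
variance at every mean value. The last field says that the expectation of `-ln M_μ(Z)` under `P_μ`
is finite, so that redundancy relative to `M` is not a difference of two infinite quantities. -/
structure HasLargerVariance {Z : Type*} [MeasurableSpace Z] {ν ρ : Measure Z} {X : Z → ℝ}
    (P : ExpFamily ρ X) (M : ExpFamily ν X) : Prop where
  meanSpace_eq : P.meanSpace = M.meanSpace
  var_lt : ∀ μ ∈ M.meanSpace, M.varX μ < P.varX μ
  logLoss_finite : ∀ μ ∈ M.meanSpace,
    expectation (P.dist μ) (M.logLoss μ) ≠ ⊤ ∧ expectation (P.dist μ) (M.logLoss μ) ≠ ⊥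

end

/-!
Any family `P` with larger variances will do. The difference between the codelength of a plug-in
model and that of `M_μ` is affine in each new outcome: it is a martingale transform of `X - μ` plus
the compensator `∑ relEnt μ μ̄ᵢ`. Hence the redundancy for outcomes from `P_μ` is infinite or at
least the expected cumulative divergence `∑ E[D_M(μ ‖ μ̄ᵢ)]`
(`integrable_transformSum`, `PlugInModel.redundancy_eq_top_or_le`). The divergence of a family has
the derivative `(μ' - μ) / var μ'` in its second argument `μ'`. On an interval where
`r var_M ≤ var_P` it is therefore at least `r` times the divergence `D_P(μ ‖ ·)` within `P`,
evaluated at the estimate truncated to the interval (`ExpFamily.mul_relEnt_projIcc_le`).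

This reduces everything to predicting a sample from `P_μ` by members of `P`, where Rissanen's bound
holds: for almost every `μ` the cumulative divergence is eventually at least `κ ln n`, for each
`κ < 1 / 2` (`ExpFamily.ae_eventually_mul_log_le_cumRelEnt`). Indeed the predictions define a single
probability distribution of `n` outcomes, whose log-likelihood ratio to `P_μⁿ` has the cumulative
divergence as its mean. If this mean is below `κ ln n`, then the predictive distribution gives
probability at least of the order `n ^ (-κ')`, with `κ' < 1 / 2` slightly above `κ`, to sample
averages within slightly more than `n ^ (-1/2)` of `μ`. By Tonelli's theorem the set of such `μ` has
measure at most a negative power of `n`, and the Borel-Cantelli lemma along powers of two concludes.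
Letting `r` and `κ` increase to the ratio of the variances and to `1 / 2` gives the theorem.
-/

/-! ### Calculus of a regular exponential family in its mean-value parameterization -/

namespace ExpFamily

variable {Z : Type*} [MeasurableSpace Z] {ν : Measure Z} {X : Z → ℝ}

/-- The carrier measure `h dν` of an exponential family. -/
noncomputable def base (M : ExpFamily ν X) : Measure Z :=
  ν.withDensity fun z => (M.h z : ℝ≥0∞)

/-- The tilting parameter `t = -η` of the member with mean `μ`; in terms of it the member is the
carrier measure tilted by `exp (t X)`, which is Mathlib's sign convention for `cgf`. -/
noncomputable def tilt (M : ExpFamily ν X) (μ : ℝ) : ℝ := -M.natParam μ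

/-- The relative entropy `D(M_μ' ‖ M_μ)`, written as a Bregman divergence. For outcomes with
mean `μ'` from any distribution it is the excess expected log loss of `M_μ` over `M_μ'`. -/
noncomputable def relEnt (M : ExpFamily ν X) (μ' μ : ℝ) : ℝ :=
  (M.tilt μ' - M.tilt μ) * μ' - cgf X M.base (M.tilt μ') + cgf X M.base (M.tilt μ)

variable (M : ExpFamily ν X)

lemma partitionFn_eq (hX : Measurable X) (η : ℝ) :
    partitionFn ν X M.h η = ∫⁻ z, ENNReal.ofReal (Real.exp (-η * X z)) ∂M.base := by
  rw [base, lintegral_withDensity_eq_lintegral_mul _ (by have := M.measurable_h; fun_prop)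
    (by fun_prop)]
  simp [partitionFn, mul_comm]

lemma mem_natSpace_iff (hX : Measurable X) (η : ℝ) :
    η ∈ natSpace ν X M.h ↔ -η ∈ integrableExpSet X M.base := by
  have hm : AEStronglyMeasurable (fun z => Real.exp (-η * X z)) M.base := by fun_prop
  rw [natSpace, Set.mem_ofPred_eq, partitionFn_eq M hX, integrableExpSet, Set.mem_ofPred_eq,
    lt_top_iff_ne_top,
    lintegral_ofReal_ne_top_iff_integrable hm (ae_of_all _ fun z => (Real.exp_pos _).le)]

lemma isOpen_integrableExpSet (hX : Measurable X) : IsOpen (integrableExpSet X M.base) := by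
  have : integrableExpSet X M.base = (fun t => -t) ⁻¹' natSpace ν X M.h := by
    ext t
    simp [mem_natSpace_iff M hX]
  rw [this]
  exact M.isOpen_natSpace.preimage continuous_neg

lemma mem_interior_iff (hX : Measurable X) {t : ℝ} :
    t ∈ interior (integrableExpSet X M.base) ↔ t ∈ integrableExpSet X M.base := by
  rw [(M.isOpen_integrableExpSet hX).interior_eq]

instance neZero_base : NeZero M.base := by
  refine ⟨fun h => M.nondegenerate ⟨0, ?_⟩⟩
  change ∀ᵐ z ∂M.base, X z = 0
  simp [h]

lemma ofReal_mgf (hX : Measurable X) {t : ℝ} (ht : t ∈ integrableExpSet X M.base) :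
    ENNReal.ofReal (mgf X M.base t) = partitionFn ν X M.h (-t) := by
  rw [partitionFn_eq M hX, mgf,
    ofReal_integral_eq_lintegral_ofReal ht (ae_of_all _ fun z => (Real.exp_pos _).le)]
  simp

lemma natDensity_eq (hX : Measurable X) {t : ℝ} (ht : t ∈ integrableExpSet X M.base) (z : Z) :
    M.natDensity (-t) z =
      (M.h z : ℝ≥0∞) * ENNReal.ofReal (Real.exp (t * X z - cgf X M.base t)) := by
  have hpos : 0 < mgf X M.base t := mgf_pos' (NeZero.ne _) ht
  rw [natDensity, ← M.ofReal_mgf hX ht, Real.exp_sub, exp_cgf ht, ENNReal.ofReal_div_of_pos hpos,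
    neg_neg, div_eq_mul_inv, div_eq_mul_inv]
  ring

lemma withDensity_natDensity (hX : Measurable X) {t : ℝ} (ht : t ∈ integrableExpSet X M.base) :
    ν.withDensity (M.natDensity (-t)) = M.base.tilted (t * X ·) := by
  have h1 : M.natDensity (-t) = (fun z => (M.h z : ℝ≥0∞)) *
      fun z => ENNReal.ofReal (Real.exp (t * X z - cgf X M.base t)) := by
    ext z
    exact M.natDensity_eq hX ht z
  have h2 (z : Z) : Real.exp (t * X z) / ∫ z, Real.exp (t * X z) ∂M.base =
      Real.exp (t * X z - cgf X M.base t) := by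
    rw [Real.exp_sub, exp_cgf ht, mgf]
  rw [h1, withDensity_mul _ (by have := M.measurable_h; fun_prop) (by fun_prop), Measure.tilted]
  simp only [h2]
  rw [base]

lemma natMean_eq (hX : Measurable X) {t : ℝ} (ht : t ∈ integrableExpSet X M.base) :
    M.natMean (-t) = deriv (cgf X M.base) t := by
  rw [natMean, withDensity_natDensity M hX ht,
    integral_tilted_mul_self ((M.mem_interior_iff hX).2 ht)]

lemma meanSpace_eq_image (hX : Measurable X) :
    M.meanSpace = deriv (cgf X M.base) '' integrableExpSet X M.base := by
  ext μ
  constructor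
  · rintro ⟨η, hη, rfl⟩
    have := (M.mem_natSpace_iff hX η).1 hη
    exact ⟨-η, this, by rw [← natMean_eq M hX this, neg_neg]⟩
  · rintro ⟨t, ht, rfl⟩
    exact ⟨-t, (M.mem_natSpace_iff hX _).2 (by simpa using ht), natMean_eq M hX ht⟩

lemma tilt_mem (hX : Measurable X) {μ : ℝ} (hμ : μ ∈ M.meanSpace) :
    M.tilt μ ∈ integrableExpSet X M.base :=
  (M.mem_natSpace_iff hX _).1 (Function.invFunOn_mem hμ)

lemma deriv_cgf_tilt (hX : Measurable X) {μ : ℝ} (hμ : μ ∈ M.meanSpace) :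
    deriv (cgf X M.base) (M.tilt μ) = μ := by
  rw [← natMean_eq M hX (M.tilt_mem hX hμ), tilt, neg_neg]
  exact Function.invFunOn_eq hμ

lemma dist_eq (hX : Measurable X) {μ : ℝ} (hμ : μ ∈ M.meanSpace) :
    M.dist μ = M.base.tilted (M.tilt μ * X ·) := by
  rw [← withDensity_natDensity M hX (M.tilt_mem hX hμ), tilt, neg_neg]
  rfl

lemma isProbabilityMeasure_dist (hX : Measurable X) {μ : ℝ} (hμ : μ ∈ M.meanSpace) :
    IsProbabilityMeasure (M.dist μ) := by
  rw [dist_eq M hX hμ]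
  exact isProbabilityMeasure_tilted (M.tilt_mem hX hμ)

lemma memLp_dist (hX : Measurable X) {μ : ℝ} (hμ : μ ∈ M.meanSpace) :
    MemLp X 2 (M.dist μ) := by
  rw [dist_eq M hX hμ]
  exact memLp_tilted_mul ((M.mem_interior_iff hX).2 (M.tilt_mem hX hμ)) 2

lemma integrable_dist (hX : Measurable X) {μ : ℝ} (hμ : μ ∈ M.meanSpace) :
    Integrable X (M.dist μ) :=
  have := M.isProbabilityMeasure_dist hX hμ
  (M.memLp_dist hX hμ).integrable (by norm_num)

lemma integral_dist (hX : Measurable X) {μ : ℝ} (hμ : μ ∈ M.meanSpace) :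
    ∫ z, X z ∂M.dist μ = μ := by
  rw [dist_eq M hX hμ, integral_tilted_mul_self ((M.mem_interior_iff hX).2 (M.tilt_mem hX hμ)),
    M.deriv_cgf_tilt hX hμ]

lemma varX_eq (hX : Measurable X) {μ : ℝ} (hμ : μ ∈ M.meanSpace) :
    M.varX μ = iteratedDeriv 2 (cgf X M.base) (M.tilt μ) := by
  rw [varX, dist_eq M hX hμ, variance_tilted_mul ((M.mem_interior_iff hX).2 (M.tilt_mem hX hμ))]

lemma iteratedDeriv_two_cgf_pos (hX : Measurable X) {t : ℝ} (ht : t ∈ integrableExpSet X M.base) :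
    0 < iteratedDeriv 2 (cgf X M.base) t := by
  rw [← variance_tilted_mul ((M.mem_interior_iff hX).2 ht)]
  refine (variance_nonneg _ _).lt_of_ne fun h0 => M.nondegenerate ?_
  have : IsProbabilityMeasure (M.base.tilted (t * X ·)) := isProbabilityMeasure_tilted ht
  have hmem : MemLp X 2 (M.base.tilted (t * X ·)) :=
    memLp_tilted_mul ((M.mem_interior_iff hX).2 ht) 2
  have h1 : evariance X (M.base.tilted (t * X ·)) = 0 := by
    rw [← hmem.ofReal_variance_eq, ← h0, ENNReal.ofReal_zero]
  rw [evariance_eq_zero_iff hX.aemeasurable] at h1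
  exact ⟨_, (absolutelyContinuous_tilted ht).ae_le h1⟩

lemma varX_pos (hX : Measurable X) {μ : ℝ} (hμ : μ ∈ M.meanSpace) : 0 < M.varX μ := by
  rw [varX_eq M hX hμ]
  exact M.iteratedDeriv_two_cgf_pos hX (M.tilt_mem hX hμ)

lemma analyticAt_cgf_tilt (hX : Measurable X) {t : ℝ} (ht : t ∈ integrableExpSet X M.base) :
    AnalyticAt ℝ (cgf X M.base) t :=
  analyticAt_cgf ((M.mem_interior_iff hX).2 ht)

lemma hasStrictDerivAt_deriv_cgf (hX : Measurable X) {t : ℝ}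
    (ht : t ∈ integrableExpSet X M.base) :
    HasStrictDerivAt (deriv (cgf X M.base)) (iteratedDeriv 2 (cgf X M.base) t) t := by
  have h := (M.analyticAt_cgf_tilt hX ht).deriv.hasStrictDerivAt
  rwa [show deriv (deriv (cgf X M.base)) t = iteratedDeriv 2 (cgf X M.base) t by
    rw [iteratedDeriv_succ, iteratedDeriv_one]] at h

lemma strictMonoOn_deriv_cgf (hX : Measurable X) :
    StrictMonoOn (deriv (cgf X M.base)) (integrableExpSet X M.base) := by
  refine strictMonoOn_of_deriv_pos convex_integrableExpSet
    (fun t ht => (M.hasStrictDerivAt_deriv_cgf hX ht).hasDerivAt.continuousAt.continuousWithinAt)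
    fun t ht => ?_
  have ht := interior_subset ht
  rw [(M.hasStrictDerivAt_deriv_cgf hX ht).hasDerivAt.deriv]
  exact M.iteratedDeriv_two_cgf_pos hX ht

/-- Near `μ`, the tilting parameter is the local inverse of the strictly increasing derivative of the
cumulant generating function; in particular, a neighborhood of `μ` consists of means. -/
lemma exists_localInverse_eq_tilt (hX : Measurable X) {μ : ℝ} (hμ : μ ∈ M.meanSpace) :
    ∃ g : ℝ → ℝ, HasStrictDerivAt g (M.varX μ)⁻¹ μ ∧ ∀ᶠ y in 𝓝 μ,
      y ∈ M.meanSpace ∧ M.tilt y = g y := by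
  have ht := M.tilt_mem hX hμ
  have hd := M.hasStrictDerivAt_deriv_cgf hX ht
  have hne := (M.iteratedDeriv_two_cgf_pos hX ht).ne'
  have hμt := M.deriv_cgf_tilt hX hμ
  have hg := hd.to_localInverse hne
  have hr := HasStrictFDerivAt.eventually_right_inverse (hd.hasStrictFDerivAt_equiv hne)
  have hc := hg.hasDerivAt.continuousAt
  have ha := HasStrictFDerivAt.localInverse_apply_image (hd.hasStrictFDerivAt_equiv hne)
  have hg' := hg
  rw [hμt] at hg'
  refine ⟨hd.localInverse _ _ _ hne, by rwa [varX_eq M hX hμ], ?_⟩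
  have hs : ∀ᶠ y in 𝓝 (deriv (cgf X M.base) (M.tilt μ)),
      hd.localInverse _ _ _ hne y ∈ integrableExpSet X M.base := by
    refine hc.eventually ((M.isOpen_integrableExpSet hX).mem_nhds ?_)
    exact Set.mem_of_eq_of_mem ha ht
  rw [hμt] at hs hr
  filter_upwards [hs, hr] with y hy1 hy2
  have hy : y ∈ M.meanSpace := by
    rw [meanSpace_eq_image M hX]
    exact ⟨_, hy1, hy2⟩
  refine ⟨hy, (M.strictMonoOn_deriv_cgf hX).injOn (M.tilt_mem hX hy) hy1 ?_⟩
  rw [M.deriv_cgf_tilt hX hy]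
  exact hy2.symm

lemma hasDerivAt_tilt (hX : Measurable X) {μ : ℝ} (hμ : μ ∈ M.meanSpace) :
    HasDerivAt M.tilt (M.varX μ)⁻¹ μ := by
  obtain ⟨g, hg, he⟩ := M.exists_localInverse_eq_tilt hX hμ
  exact hg.hasDerivAt.congr_of_eventuallyEq (he.mono fun y hy => hy.2)

lemma isOpen_meanSpace (hX : Measurable X) : IsOpen M.meanSpace := by
  rw [isOpen_iff_mem_nhds]
  intro μ hμ
  obtain ⟨g, hg, he⟩ := M.exists_localInverse_eq_tilt hX hμ
  exact he.mono fun y hy => hy.1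

lemma ordConnected_meanSpace (hX : Measurable X) : M.meanSpace.OrdConnected := by
  rw [meanSpace_eq_image M hX]
  refine (convex_integrableExpSet.isPreconnected.image _ fun t ht => ?_).ordConnected
  exact (M.hasStrictDerivAt_deriv_cgf hX ht).hasDerivAt.continuousAt.continuousWithinAt

lemma continuousOn_tilt (hX : Measurable X) : ContinuousOn M.tilt M.meanSpace :=
  fun _ hμ => (M.hasDerivAt_tilt hX hμ).continuousAt.continuousWithinAt

lemma hasDerivAt_cgf_comp_tilt (hX : Measurable X) {μ : ℝ} (hμ : μ ∈ M.meanSpace) :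
    HasDerivAt (fun μ => cgf X M.base (M.tilt μ)) (μ * (M.varX μ)⁻¹) μ := by
  have h := (M.analyticAt_cgf_tilt hX (M.tilt_mem hX hμ)).differentiableAt.hasDerivAt
  rw [M.deriv_cgf_tilt hX hμ] at h
  exact h.comp μ (M.hasDerivAt_tilt hX hμ)

lemma continuousAt_varX (hX : Measurable X) {μ : ℝ} (hμ : μ ∈ M.meanSpace) :
    ContinuousAt M.varX μ := by
  have h1 : ContinuousAt (fun y => iteratedDeriv 2 (cgf X M.base) (M.tilt y)) μ := by
    refine ContinuousAt.comp (g := iteratedDeriv 2 (cgf X M.base)) ?_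
      (M.hasDerivAt_tilt hX hμ).continuousAt
    have := (M.analyticAt_cgf_tilt hX (M.tilt_mem hX hμ)).deriv.deriv.continuousAt
    rwa [show deriv (deriv (cgf X M.base)) = iteratedDeriv 2 (cgf X M.base) by
      rw [iteratedDeriv_succ, iteratedDeriv_one]] at this
  refine h1.congr ?_
  filter_upwards [(M.isOpen_meanSpace hX).mem_nhds hμ] with y hy
  exact (M.varX_eq hX hy).symm

@[simp]
lemma relEnt_self (μ : ℝ) : M.relEnt μ μ = 0 := by
  simp [relEnt]

lemma hasDerivAt_relEnt (hX : Measurable X) (μ' : ℝ) {μ : ℝ} (hμ : μ ∈ M.meanSpace) :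
    HasDerivAt (M.relEnt μ') ((μ - μ') * (M.varX μ)⁻¹) μ := by
  have h1 := ((M.hasDerivAt_tilt hX hμ).const_sub (M.tilt μ')).mul_const μ'
  have h2 := (h1.sub_const (cgf X M.base (M.tilt μ'))).add (M.hasDerivAt_cgf_comp_tilt hX hμ)
  refine h2.congr_deriv ?_
  ring

end ExpFamily

/-- A function whose derivative at `x` has the sign of `x - m` grows when moving away from `m`. -/
lemma le_of_hasDerivAt_sub_mul {g c : ℝ → ℝ} {s : Set ℝ} (hs : s.OrdConnected) {m x y : ℝ}
    (hg : ∀ x ∈ s, HasDerivAt g ((x - m) * c x) x) (hc : ∀ x ∈ s, 0 ≤ c x)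
    (hm : m ∈ s) (hx : x ∈ s) (hy : y ∈ Set.uIcc m x) : g y ≤ g x := by
  have hsub : Set.uIcc m x ⊆ s := hs.uIcc_subset hm hx
  have hcont : ContinuousOn g (Set.uIcc m x) :=
    fun z hz => (hg z (hsub hz)).continuousAt.continuousWithinAt
  rcases le_total m x with h | h
  · rw [Set.uIcc_of_le h] at hsub hcont hy
    refine monotoneOn_of_deriv_nonneg (convex_Icc m x) hcont
      (fun z hz => (hg z (hsub (interior_subset hz))).differentiableAt.differentiableWithinAt)
      (fun z hz => ?_) hy ⟨h, le_rfl⟩ hy.2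
    have hz := interior_subset hz
    rw [(hg z (hsub hz)).deriv]
    exact mul_nonneg (sub_nonneg.2 hz.1) (hc z (hsub hz))
  · rw [Set.uIcc_of_ge h] at hsub hcont hy
    refine antitoneOn_of_deriv_nonpos (convex_Icc x m) hcont
      (fun z hz => (hg z (hsub (interior_subset hz))).differentiableAt.differentiableWithinAt)
      (fun z hz => ?_) ⟨le_rfl, h⟩ hy hy.1
    have hz := interior_subset hz
    rw [(hg z (hsub hz)).deriv]
    exact mul_nonpos_of_nonpos_of_nonneg (sub_nonpos.2 hz.2) (hc z (hsub hz))

namespace ExpFamily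

variable {Z : Type*} [MeasurableSpace Z] {ν ρ : Measure Z} {X : Z → ℝ}

lemma relEnt_nonneg (M : ExpFamily ν X) (hX : Measurable X) {μ' μ : ℝ} (hμ' : μ' ∈ M.meanSpace)
    (hμ : μ ∈ M.meanSpace) : 0 ≤ M.relEnt μ' μ := by
  rw [← M.relEnt_self μ']
  exact le_of_hasDerivAt_sub_mul (M.ordConnected_meanSpace hX)
    (fun x hx => M.hasDerivAt_relEnt hX μ' hx) (fun x hx => (inv_pos.2 (M.varX_pos hX hx)).le)
    hμ' hμ Set.left_mem_uIcc

/-- Where the variances of `P` exceed `r` times those of `M`, the divergence of `M` exceeds `r`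
times the divergence of `P`, even if the second argument of the latter is moved into an interval
around the first one. Truncation is what makes this local comparison global. -/
lemma mul_relEnt_projIcc_le (M : ExpFamily ν X) (P : ExpFamily ρ X) (hX : Measurable X)
    {a b r μ' μ : ℝ} (hab : a ≤ b) (hM : Set.Icc a b ⊆ M.meanSpace) (hP : Set.Icc a b ⊆ P.meanSpace)
    (hr : ∀ x ∈ Set.Icc a b, r * M.varX x ≤ P.varX x) (hμ' : μ' ∈ Set.Icc a b)
    (hμ : μ ∈ M.meanSpace) :
    r * P.relEnt μ' (Set.projIcc a b hab μ : ℝ) ≤ M.relEnt μ' μ := by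
  set y : ℝ := (Set.projIcc a b hab μ : ℝ) with hy
  have hyI : y ∈ Set.Icc a b := (Set.projIcc a b hab μ).2
  have hyu : y ∈ Set.uIcc μ' μ := by
    rw [hy, Set.coe_projIcc, Set.mem_uIcc]
    have h1 := hμ'.1
    have h2 := hμ'.2
    rcases le_total μ' μ with h | h
    · exact Or.inl ⟨le_max_of_le_right (le_min h2 h), max_le (h1.trans h) (min_le_right _ _)⟩
    · refine Or.inr ⟨le_max_of_le_right (le_min (h.trans h2) le_rfl),
        max_le h1 ((min_le_right _ _).trans h)⟩
  have hder : ∀ x ∈ Set.Icc a b, HasDerivAt (fun x => M.relEnt μ' x - r * P.relEnt μ' x)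
      ((x - μ') * ((M.varX x)⁻¹ - r * (P.varX x)⁻¹)) x := fun x hx =>
    ((M.hasDerivAt_relEnt hX μ' (hM hx)).sub
      ((P.hasDerivAt_relEnt hX μ' (hP hx)).const_mul r)).congr_deriv (by ring)
  have hle : M.relEnt μ' μ' - r * P.relEnt μ' μ' ≤ M.relEnt μ' y - r * P.relEnt μ' y := by
    refine le_of_hasDerivAt_sub_mul (g := fun x => M.relEnt μ' x - r * P.relEnt μ' x)
      Set.ordConnected_Icc hder (fun x hx => ?_) hμ' hyI Set.left_mem_uIcc
    have h1 := M.varX_pos hX (hM hx)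
    have h2 := P.varX_pos hX (hP hx)
    rw [sub_nonneg, ← div_eq_mul_inv, div_le_iff₀ h2, inv_mul_eq_div, le_div_iff₀ h1]
    exact hr x hx
  have hle2 : M.relEnt μ' y ≤ M.relEnt μ' μ :=
    le_of_hasDerivAt_sub_mul (M.ordConnected_meanSpace hX)
      (fun x hx => M.hasDerivAt_relEnt hX μ' hx) (fun x hx => (inv_pos.2 (M.varX_pos hX hx)).le)
      (hM hμ') hμ hyu
  simp only [relEnt_self, mul_zero, sub_zero] at hle
  linarith

end ExpFamily

/-! ### Sums of predictable increments over independent outcomes -/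

section Sequential

variable {Z : Type*} [MeasurableSpace Z]

instance isProbabilityMeasure_iidLaw (Q : Measure Z) [IsProbabilityMeasure Q] (n : ℕ) :
    IsProbabilityMeasure (iidLaw Q n) := by
  unfold iidLaw
  infer_instance

lemma measurePreserving_snoc (Q : Measure Z) [IsProbabilityMeasure Q] (n : ℕ) :
    MeasurePreserving (fun p : (Fin n → Z) × Z => Fin.snoc (α := fun _ => Z) p.1 p.2)
      ((iidLaw Q n).prod Q) (iidLaw Q (n + 1)) := by
  have h1 := (measurePreserving_piFinSuccAbove (fun _ : Fin (n + 1) => Q) (Fin.last n)).symm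
  have h2 : MeasurePreserving Prod.swap ((iidLaw Q n).prod Q) (Q.prod (iidLaw Q n)) :=
    Measure.measurePreserving_swap
  have h3 : (fun p : (Fin n → Z) × Z => Fin.snoc (α := fun _ => Z) p.1 p.2) =
      (MeasurableEquiv.piFinSuccAbove (fun _ : Fin (n + 1) => Z) (Fin.last n)).symm ∘ Prod.swap := by
    ext p
    simp [MeasurableEquiv.piFinSuccAbove, Fin.insertNthEquiv]
  rw [h3]
  exact h1.comp h2

@[fun_prop]
lemma measurable_snoc (n : ℕ) :
    Measurable fun p : (Fin n → Z) × Z => Fin.snoc (α := fun _ => Z) p.1 p.2 := by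
  refine measurable_pi_iff.2 fun i => ?_
  refine Fin.lastCases ?_ (fun j => ?_) i
  · simpa using measurable_snd
  · simp only [Fin.snoc_castSucc]
    fun_prop

lemma lintegral_iidLaw_succ (Q : Measure Z) [IsProbabilityMeasure Q] (n : ℕ)
    {F : (Fin (n + 1) → Z) → ℝ≥0∞} (hF : Measurable F) :
    ∫⁻ z, F z ∂iidLaw Q (n + 1) =
      ∫⁻ z, ∫⁻ x, F (Fin.snoc (α := fun _ => Z) z x) ∂Q ∂iidLaw Q n := by
  rw [← (measurePreserving_snoc Q n).lintegral_comp hF, lintegral_prod]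
  exact (hF.comp (measurable_snoc n)).aemeasurable

/-- The sum over `i < n` of `ξ i z₁ … zᵢ * Y zᵢ₊₁ + d i z₁ … zᵢ`. If `Y` has mean zero, then the
first summands form a martingale transform and the second ones the compensator. -/
def transformSum (ξ d : (i : ℕ) → (Fin i → Z) → ℝ) (Y : Z → ℝ) (n : ℕ) (z : Fin n → Z) : ℝ :=
  ∑ i : Fin n, (ξ i (fun j : Fin i => z (Fin.castLE i.isLt.le j)) * Y (z i) +
    d i (fun j : Fin i => z (Fin.castLE i.isLt.le j)))

variable {ξ d : (i : ℕ) → (Fin i → Z) → ℝ} {Y : Z → ℝ}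

omit [MeasurableSpace Z] in
lemma transformSum_snoc (n : ℕ) (z : Fin n → Z) (x : Z) :
    transformSum ξ d Y (n + 1) (Fin.snoc (α := fun _ => Z) z x) =
      transformSum ξ d Y n z + (ξ n z * Y x + d n z) := by
  have h (i : Fin n) (j : Fin i) : Fin.snoc (α := fun _ => Z) z x
      (Fin.castLE (i.castSucc).isLt.le j) = z (Fin.castLE i.isLt.le j) :=
    Fin.snoc_castSucc (α := fun _ => Z) x z (Fin.castLE i.isLt.le j)
  have h' (j : Fin n) : Fin.snoc (α := fun _ => Z) z x
      (Fin.castLE (Fin.last n).isLt.le j) = z j :=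
    Fin.snoc_castSucc (α := fun _ => Z) x z j
  rw [transformSum, Fin.sum_univ_castSucc, transformSum]
  congr 1
  · refine Finset.sum_congr rfl fun i _ => ?_
    rw [Fin.snoc_castSucc]
    simp only [← h]
    rfl
  · rw [Fin.snoc_last]
    have : (fun j : Fin (Fin.last n : ℕ) => Fin.snoc (α := fun _ => Z) z x
        (Fin.castLE (Fin.last n).isLt.le j)) = z := funext h'
    simp only [this]
    rfl

lemma measurable_transformSum (hξ : ∀ i, Measurable (ξ i)) (hd : ∀ i, Measurable (d i))
    (hY : Measurable Y) (n : ℕ) : Measurable (transformSum ξ d Y n) := by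
  unfold transformSum
  refine Finset.measurable_sum _ fun i _ => ?_
  have h1 : Measurable fun (z : Fin n → Z) (j : Fin i) => z (Fin.castLE i.isLt.le j) := by fun_prop
  exact (((hξ i).comp h1).mul (hY.comp (measurable_pi_apply i))).add ((hd i).comp h1)

lemma ofReal_integral_le_lintegral_ofReal {Ω : Type*} [MeasurableSpace Ω] {Q : Measure Ω}
    {f : Ω → ℝ} (hf : Integrable f Q) :
    ENNReal.ofReal (∫ x, f x ∂Q) ≤ ∫⁻ x, ENNReal.ofReal (f x) ∂Q := by
  refine (ENNReal.ofReal_le_ofReal (integral_mono hf hf.pos_part fun x => le_max_left _ 0)).trans ?_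
  rw [ofReal_integral_eq_lintegral_ofReal hf.pos_part (ae_of_all _ fun x => le_max_right _ _)]
  refine lintegral_mono fun x => ?_
  simp

/-- A sum of a martingale transform and a nonnegative compensator is integrable, and its mean is
that of the compensator, as soon as its positive part has finite mean; no integrability of the
single increments is required. Conditioning on all but the last outcome shows that the positive part
of every shorter sum has finite mean, and then Fubini's theorem bounds the negative part. -/
theorem integrable_transformSum {Q : Measure Z} [IsProbabilityMeasure Q]
    (hξ : ∀ i, Measurable (ξ i)) (hd : ∀ i, Measurable (d i)) (hd0 : ∀ i z, 0 ≤ d i z)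
    (hYm : Measurable Y) (hY : Integrable Y Q) (hY0 : ∫ x, Y x ∂Q = 0) (n : ℕ)
    (h : ∫⁻ z, ENNReal.ofReal (transformSum ξ d Y n z) ∂iidLaw Q n ≠ ∞) :
    Integrable (transformSum ξ d Y n) (iidLaw Q n) ∧
      (∀ i < n, Integrable (d i) (iidLaw Q i)) ∧
      ∫ z, transformSum ξ d Y n z ∂iidLaw Q n =
        ∑ i ∈ Finset.range n, ∫ z, d i z ∂iidLaw Q i := by
  induction n with
  | zero => simp [transformSum]
  | succ n ih =>
    have hGm := measurable_transformSum hξ hd hYm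
    set G := transformSum ξ d Y with hG
    set F : (Fin n → Z) × Z → ℝ := fun p => G (n + 1) (Fin.snoc (α := fun _ => Z) p.1 p.2) with hF
    have hFm : Measurable F := (hGm (n + 1)).comp (measurable_snoc n)
    have hFeq (z : Fin n → Z) (x : Z) : F (z, x) = (G n z + d n z) + ξ n z * Y x := by
      simp only [hF, hG, transformSum_snoc]
      ring
    have hFint (z : Fin n → Z) : Integrable (fun x => F (z, x)) Q := by
      simp only [hFeq]
      exact (integrable_const _).add (hY.const_mul _)
    have hFmean (z : Fin n → Z) : ∫ x, F (z, x) ∂Q = G n z + d n z := by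
      simp only [hFeq]
      rw [integral_add (integrable_const _) (hY.const_mul _), integral_const_mul, hY0]
      simp
    have hHm : Measurable fun z => G n z + d n z := (hGm n).add (hd n)
    have hFpos : ∫⁻ p, ENNReal.ofReal (F p) ∂(iidLaw Q n).prod Q ≠ ∞ := by
      rwa [← (measurePreserving_snoc Q n).lintegral_comp (hGm (n + 1)).ennreal_ofReal] at h
    have hHpos : ∫⁻ z, ENNReal.ofReal (G n z + d n z) ∂iidLaw Q n ≠ ∞ := by
      refine ne_top_of_le_ne_top hFpos ?_
      rw [lintegral_prod _ hFm.ennreal_ofReal.aemeasurable]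
      refine lintegral_mono fun z => ?_
      rw [← hFmean z]
      exact ofReal_integral_le_lintegral_ofReal (hFint z)
    obtain ⟨hGi, hdi, hGe⟩ := ih (ne_top_of_le_ne_top hHpos (lintegral_mono fun z =>
      ENNReal.ofReal_le_ofReal (le_add_of_nonneg_right (hd0 n z))))
    have hHposi : Integrable (fun z => max (G n z + d n z) 0) (iidLaw Q n) := by
      have hm : Measurable fun z => max (G n z + d n z) 0 := hHm.max measurable_const
      refine (lintegral_ofReal_ne_top_iff_integrable hm.aestronglyMeasurable
        (ae_of_all _ fun z => le_max_right _ _)).1 ?_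
      simpa using hHpos
    have hdn : Integrable (d n) (iidLaw Q n) := by
      refine (hHposi.add hGi.abs).mono' (hd n).aestronglyMeasurable (ae_of_all _ fun z => ?_)
      rw [Real.norm_of_nonneg (hd0 n z)]
      have h1 := le_max_left (G n z + d n z) 0
      have h2 := neg_abs_le (G n z)
      simp only [Pi.add_apply]
      linarith
    have hFposi : Integrable (fun p => max (F p) 0) ((iidLaw Q n).prod Q) := by
      have hm : Measurable fun p => max (F p) 0 := hFm.max measurable_const
      refine (lintegral_ofReal_ne_top_iff_integrable hm.aestronglyMeasurable
        (ae_of_all _ fun z => le_max_right _ _)).1 ?_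
      simpa using hFpos
    have hFi : Integrable F ((iidLaw Q n).prod Q) := by
      rw [integrable_prod_iff hFm.aestronglyMeasurable]
      refine ⟨ae_of_all _ hFint, ?_⟩
      have h1 (z : Fin n → Z) : ∫ x, ‖F (z, x)‖ ∂Q =
          2 * ∫ x, max (F (z, x)) 0 ∂Q - (G n z + d n z) := by
        rw [← hFmean z, ← integral_const_mul,
          ← integral_sub ((hFint z).pos_part.const_mul 2) (hFint z)]
        refine integral_congr_ae (ae_of_all _ fun x => ?_)
        rcases le_total 0 (F (z, x)) with h | h
        · simp only [max_eq_left h, Real.norm_of_nonneg h]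
          ring
        · simp only [max_eq_right h, Real.norm_of_nonpos h]
          ring
      simp only [h1]
      exact (hFposi.integral_prod_left.const_mul 2).sub (hGi.add hdn)
    have hmp := measurePreserving_snoc Q n
    have hint : Integrable (G (n + 1)) (iidLaw Q (n + 1)) := by
      rwa [← hmp.integrable_comp (hGm (n + 1)).aestronglyMeasurable]
    refine ⟨hint, fun i hi => ?_, ?_⟩
    · rcases Nat.lt_succ_iff_lt_or_eq.1 hi with hi | rfl
      exacts [hdi i hi, hdn]
    · rw [Finset.sum_range_succ, ← hGe, ← integral_add hGi hdn, ← hmp.map_eq,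
        integral_map hmp.measurable.aemeasurable (by rw [hmp.map_eq]; exact hint.1)]
      change ∫ p, F p ∂_ = _
      rw [integral_prod _ hFi]
      simp only [hFmean]

end Sequential

/-! ### The sequential predictive distribution -/

namespace ExpFamily

variable {Z : Type*} [MeasurableSpace Z] {ν : Measure Z} {X : Z → ℝ} (M : ExpFamily ν X)

/-- The log-likelihood ratio `ln M_μ(zⁿ) - ∑ ln M_{vᵢ}(zᵢ₊₁)` of the member with mean `μ` to the
sequential predictions with means `v i z₁ … zᵢ`, sorted into a martingale transform of `X - μ` and
the compensator `∑ relEnt μ vᵢ`. -/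
noncomputable def logRatio (v : (i : ℕ) → (Fin i → Z) → ℝ) (μ : ℝ) (n : ℕ) (z : Fin n → Z) : ℝ :=
  transformSum (fun i z => M.tilt μ - M.tilt (v i z)) (fun i z => M.relEnt μ (v i z))
    (fun x => X x - μ) n z

lemma measurable_tilt_comp (hX : Measurable X) {Ω : Type*} [MeasurableSpace Ω] {v : Ω → ℝ}
    (hv : Measurable v) (hmem : ∀ z, v z ∈ M.meanSpace) : Measurable fun z => M.tilt (v z) :=
  (continuousOn_iff_continuous_domRestrict.1 (M.continuousOn_tilt hX)).measurable.comp
    (hv.subtype_mk (h := hmem))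

lemma continuousOn_relEnt (hX : Measurable X) (μ : ℝ) : ContinuousOn (M.relEnt μ) M.meanSpace :=
  fun _ hx => (M.hasDerivAt_relEnt hX μ hx).continuousAt.continuousWithinAt

lemma measurable_relEnt_comp (hX : Measurable X) (μ : ℝ) {Ω : Type*} [MeasurableSpace Ω] {v : Ω → ℝ}
    (hv : Measurable v) (hmem : ∀ z, v z ∈ M.meanSpace) : Measurable fun z => M.relEnt μ (v z) :=
  (continuousOn_iff_continuous_domRestrict.1 (M.continuousOn_relEnt hX μ)).measurable.comp
    (hv.subtype_mk (h := hmem))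

section

variable {v : (i : ℕ) → (Fin i → Z) → ℝ} (hX : Measurable X) (hv : ∀ i, Measurable (v i))
  (hmem : ∀ i z, v i z ∈ M.meanSpace)
include hX hv hmem

lemma measurable_logRatio (μ : ℝ) (n : ℕ) : Measurable (M.logRatio v μ n) :=
  measurable_transformSum
    (fun i => measurable_const.sub (M.measurable_tilt_comp hX (hv i) (hmem i)))
    (fun i => M.measurable_relEnt_comp hX μ (hv i) (hmem i)) (hX.sub_const μ) n

/-- If the positive part of the log-likelihood ratio has finite mean under some distribution under
which `X` has mean `μ`, then its mean is the expected cumulative divergence. -/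
lemma integrable_logRatio {μ : ℝ} (hμ : μ ∈ M.meanSpace) {Q : Measure Z} [IsProbabilityMeasure Q]
    (hQ : Integrable X Q) (hQμ : ∫ z, X z ∂Q = μ) (n : ℕ)
    (h : ∫⁻ z, ENNReal.ofReal (M.logRatio v μ n z) ∂iidLaw Q n ≠ ∞) :
    Integrable (M.logRatio v μ n) (iidLaw Q n) ∧
      (∀ i < n, Integrable (fun z => M.relEnt μ (v i z)) (iidLaw Q i)) ∧
      ∫ z, M.logRatio v μ n z ∂iidLaw Q n =
        ∑ i ∈ Finset.range n, ∫ z, M.relEnt μ (v i z) ∂iidLaw Q i :=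
  integrable_transformSum
    (fun i => measurable_const.sub (M.measurable_tilt_comp hX (hv i) (hmem i)))
    (fun i => M.measurable_relEnt_comp hX μ (hv i) (hmem i))
    (fun i z => M.relEnt_nonneg hX hμ (hmem i z)) (hX.sub_const μ)
    (hQ.sub (integrable_const μ))
    (by rw [integral_sub hQ (integrable_const μ), hQμ]; simp) n h

end

lemma lintegral_dist (hX : Measurable X) {μ : ℝ} (hμ : μ ∈ M.meanSpace) {f : Z → ℝ≥0∞} :
    ∫⁻ x, f x ∂M.dist μ =
      ∫⁻ x, ENNReal.ofReal (Real.exp (M.tilt μ * X x - cgf X M.base (M.tilt μ))) * f x ∂M.base := by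
  rw [M.dist_eq hX hμ, lintegral_tilted]
  refine lintegral_congr fun x => ?_
  rw [Real.exp_sub, exp_cgf (M.tilt_mem hX hμ), mgf]

lemma lintegral_dist_mul_exp_neg (hX : Measurable X) {μ v : ℝ} (hμ : μ ∈ M.meanSpace)
    (hv : v ∈ M.meanSpace) (f : Z → ℝ≥0∞) :
    ∫⁻ x, f x * ENNReal.ofReal
      (Real.exp (-((M.tilt μ - M.tilt v) * (X x - μ) + M.relEnt μ v))) ∂M.dist μ =
      ∫⁻ x, f x ∂M.dist v := by
  rw [M.lintegral_dist hX hμ, M.lintegral_dist hX hv]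
  refine lintegral_congr fun x => ?_
  rw [mul_left_comm, ← ENNReal.ofReal_mul (Real.exp_pos _).le, ← Real.exp_add, mul_comm, relEnt]
  ring_nf

variable {v : (i : ℕ) → (Fin i → Z) → ℝ}

lemma lintegral_iidLaw_mul_exp_neg_logRatio_succ (hX : Measurable X) (hv : ∀ i, Measurable (v i))
    (hmem : ∀ i z, v i z ∈ M.meanSpace) {μ : ℝ} (hμ : μ ∈ M.meanSpace) (n : ℕ)
    {F : (Fin (n + 1) → Z) → ℝ≥0∞} (hF : Measurable F) :
    ∫⁻ z, F z * ENNReal.ofReal (Real.exp (-M.logRatio v μ (n + 1) z)) ∂iidLaw (M.dist μ) (n + 1) =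
      ∫⁻ z, (∫⁻ x, F (Fin.snoc (α := fun _ => Z) z x) ∂M.dist (v n z)) *
        ENNReal.ofReal (Real.exp (-M.logRatio v μ n z)) ∂iidLaw (M.dist μ) n := by
  have := M.isProbabilityMeasure_dist hX hμ
  have hm := M.measurable_logRatio hX hv hmem μ (n + 1)
  rw [lintegral_iidLaw_succ _ _ (by fun_prop)]
  refine lintegral_congr fun z => ?_
  rw [← M.lintegral_dist_mul_exp_neg hX hμ (hmem n z), mul_comm,
    ← lintegral_const_mul' _ _ ENNReal.ofReal_ne_top]
  refine lintegral_congr fun x => ?_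
  rw [mul_left_comm, ← ENNReal.ofReal_mul (Real.exp_pos _).le, ← Real.exp_add, logRatio,
    transformSum_snoc, neg_add]
  rfl

/-- Integration against the sequential predictive distribution, written as a change of measure from
`n` independent outcomes from `M_μ`, does not depend on `μ`. -/
lemma lintegral_mul_exp_neg_logRatio_congr (hX : Measurable X) (hv : ∀ i, Measurable (v i))
    (hmem : ∀ i z, v i z ∈ M.meanSpace) {μ μ' : ℝ} (hμ : μ ∈ M.meanSpace) (hμ' : μ' ∈ M.meanSpace)
    (n : ℕ) {F : (Fin n → Z) → ℝ≥0∞} (hF : Measurable F) :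
    ∫⁻ z, F z * ENNReal.ofReal (Real.exp (-M.logRatio v μ n z)) ∂iidLaw (M.dist μ) n =
      ∫⁻ z, F z * ENNReal.ofReal (Real.exp (-M.logRatio v μ' n z)) ∂iidLaw (M.dist μ') n := by
  induction n with
  | zero =>
    have := M.isProbabilityMeasure_dist hX hμ
    have := M.isProbabilityMeasure_dist hX hμ'
    have h (μ : ℝ) (z : Fin 0 → Z) : M.logRatio v μ 0 z = 0 := by simp [logRatio, transformSum]
    have h0 (μ : ℝ) [IsProbabilityMeasure (M.dist μ)] : iidLaw (M.dist μ) 0 = Measure.dirac default :=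
      Measure.pi_of_empty _ _
    simp only [h, h0]
  | succ n ih =>
    rw [M.lintegral_iidLaw_mul_exp_neg_logRatio_succ hX hv hmem hμ n hF,
      M.lintegral_iidLaw_mul_exp_neg_logRatio_succ hX hv hmem hμ' n hF]
    refine ih ?_
    have := M.isProbabilityMeasure_dist hX hμ
    have h1 := M.measurable_tilt_comp hX (hv n) (hmem n)
    have h2 := M.measurable_relEnt_comp hX μ (hv n) (hmem n)
    -- Measurability of the prediction comes from its density with respect to the finite `M_μ`.
    simp only [← M.lintegral_dist_mul_exp_neg hX hμ (hmem n _)]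
    have h3 : Measurable fun p : (Fin n → Z) × Z =>
        F (Fin.snoc (α := fun _ => Z) p.1 p.2) * ENNReal.ofReal (Real.exp
          (-((M.tilt μ - M.tilt (v n p.1)) * (X p.2 - μ) + M.relEnt μ (v n p.1)))) :=
      (hF.comp (measurable_snoc n)).mul
        ((((measurable_const.sub (h1.comp measurable_fst)).mul
          ((hX.comp measurable_snd).sub_const μ)).add (h2.comp measurable_fst)).neg.exp.ennreal_ofReal)
    exact h3.lintegral_prod_right'

lemma lintegral_exp_neg_logRatio (hX : Measurable X) (hv : ∀ i, Measurable (v i))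
    (hmem : ∀ i z, v i z ∈ M.meanSpace) {μ : ℝ} (hμ : μ ∈ M.meanSpace) (n : ℕ) :
    ∫⁻ z, ENNReal.ofReal (Real.exp (-M.logRatio v μ n z)) ∂iidLaw (M.dist μ) n = 1 := by
  have := M.isProbabilityMeasure_dist hX hμ
  induction n with
  | zero => simp [logRatio, transformSum]
  | succ n ih =>
    have h := M.lintegral_iidLaw_mul_exp_neg_logRatio_succ hX hv hmem hμ n (F := 1) measurable_one
    simp only [Pi.one_apply, one_mul, lintegral_one] at h
    rw [h, ← ih]
    refine lintegral_congr fun z => ?_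
    have := M.isProbabilityMeasure_dist hX (hmem n z)
    simp

/-- The joint distribution of `n` outcomes that are predicted sequentially with the means `v`,
written as a change of measure from `n` independent outcomes from `M_μ`. -/
noncomputable def predictiveLaw (v : (i : ℕ) → (Fin i → Z) → ℝ) (μ : ℝ) (n : ℕ) :
    Measure (Fin n → Z) :=
  (iidLaw (M.dist μ) n).withDensity fun z => ENNReal.ofReal (Real.exp (-M.logRatio v μ n z))

lemma predictiveLaw_congr (hX : Measurable X) (hv : ∀ i, Measurable (v i))
    (hmem : ∀ i z, v i z ∈ M.meanSpace) {μ μ' : ℝ} (hμ : μ ∈ M.meanSpace) (hμ' : μ' ∈ M.meanSpace)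
    (n : ℕ) : M.predictiveLaw v μ n = M.predictiveLaw v μ' n := by
  ext s hs
  have h := M.lintegral_mul_exp_neg_logRatio_congr hX hv hmem hμ hμ' n
    (F := s.indicator 1) (measurable_one.indicator hs)
  rw [predictiveLaw, predictiveLaw, withDensity_apply _ hs, withDensity_apply _ hs,
    ← lintegral_indicator hs, ← lintegral_indicator hs]
  convert h using 3 with z z
  all_goals by_cases hz : z ∈ s <;> simp [hz]

lemma isProbabilityMeasure_predictiveLaw (hX : Measurable X) (hv : ∀ i, Measurable (v i))
    (hmem : ∀ i z, v i z ∈ M.meanSpace) {μ : ℝ} (hμ : μ ∈ M.meanSpace) (n : ℕ) :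
    IsProbabilityMeasure (M.predictiveLaw v μ n) := by
  refine ⟨?_⟩
  rw [predictiveLaw, withDensity_apply _ MeasurableSet.univ, Measure.restrict_univ,
    M.lintegral_exp_neg_logRatio hX hv hmem hμ]

end ExpFamily

/-! ### Predictions with means in a compact interval -/

/-- If the expected log-likelihood ratio of `Q` to the distribution `exp (-ℓ) dQ` is at most `b`,
then an event which is likely under `Q` cannot be too unlikely under the other distribution. -/
lemma exp_neg_mul_le_setIntegral_exp_neg {Ω : Type*} [MeasurableSpace Ω] {Q : Measure Ω}
    [IsProbabilityMeasure Q] {ℓ : Ω → ℝ} (hℓ : Integrable ℓ Q)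
    (he : Integrable (fun z => Real.exp (-ℓ z)) Q) (he1 : ∫ z, Real.exp (-ℓ z) ∂Q ≤ 1)
    {b : ℝ} (hb : ∫ z, ℓ z ∂Q ≤ b) {s : Set Ω} (hs : MeasurableSet s) (a : ℝ) :
    Real.exp (-a) * ((1 + a) * Q.real s - b - 1) ≤ ∫ z in s, Real.exp (-ℓ z) ∂Q := by
  have h1 : ∫ z in s, ℓ z ∂Q ≤ b + 1 := by
    have h2 : -∫ z in sᶜ, ℓ z ∂Q ≤ 1 := by
      rw [← integral_neg]
      refine le_trans ?_ he1
      refine le_trans (integral_mono hℓ.integrableOn.neg he.integrableOn fun z => ?_)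
        (setIntegral_le_integral he (ae_of_all _ fun z => (Real.exp_pos _).le))
      have := Real.add_one_le_exp (-ℓ z)
      linarith
    rw [← integral_add_compl hs hℓ] at hb
    linarith
  have h3 : ∫ z in s, Real.exp (-a) * ((1 + a) - ℓ z) ∂Q ≤ ∫ z in s, Real.exp (-ℓ z) ∂Q := by
    refine integral_mono (((integrable_const _).sub hℓ.integrableOn).const_mul _)
      he.integrableOn fun z => ?_
    -- The convex function `ℓ ↦ exp (-ℓ)` lies above its tangent at `a`.
    have h4 := Real.add_one_le_exp (a - ℓ z)
    have h5 : Real.exp (-ℓ z) = Real.exp (-a) * Real.exp (a - ℓ z) := by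
      rw [← Real.exp_add]
      ring_nf
    simp only [h5]
    exact mul_le_mul_of_nonneg_left (by linarith) (Real.exp_pos _).le
  refine le_trans ?_ h3
  rw [integral_const_mul, integral_sub (integrable_const _) hℓ.integrableOn]
  refine mul_le_mul_of_nonneg_left ?_ (Real.exp_pos _).le
  simp only [integral_const, smul_eq_mul, measureReal_restrict_apply_univ]
  linarith

namespace ExpFamily

variable {Z : Type*} [MeasurableSpace Z] {ν : Measure Z} {X : Z → ℝ} (M : ExpFamily ν X)
  {v : (i : ℕ) → (Fin i → Z) → ℝ}

/-- The expected cumulative divergence of `n` sequential predictions with means `v`, for independent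
outcomes from `M_μ` itself. -/
noncomputable def cumRelEnt (v : (i : ℕ) → (Fin i → Z) → ℝ) (μ : ℝ) (n : ℕ) : ℝ :=
  ∑ i ∈ Finset.range n, ∫ z, M.relEnt μ (v i z) ∂iidLaw (M.dist μ) i

lemma monotone_cumRelEnt (hX : Measurable X) (hmem : ∀ i z, v i z ∈ M.meanSpace) {μ : ℝ}
    (hμ : μ ∈ M.meanSpace) : Monotone (M.cumRelEnt v μ) :=
  monotone_nat_of_le_succ fun n => by
    rw [cumRelEnt, cumRelEnt, Finset.sum_range_succ]
    exact le_add_of_nonneg_right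
      (integral_nonneg fun z => M.relEnt_nonneg hX hμ (hmem n z))

lemma integrable_logRatio_of_mem_Icc (hX : Measurable X) (hv : ∀ i, Measurable (v i)) {a b : ℝ}
    (hab : Set.Icc a b ⊆ M.meanSpace) (hmem : ∀ i z, v i z ∈ Set.Icc a b) {μ : ℝ}
    (hμ : μ ∈ M.meanSpace) (n : ℕ) :
    Integrable (M.logRatio v μ n) (iidLaw (M.dist μ) n) ∧
      ∫ z, M.logRatio v μ n z ∂iidLaw (M.dist μ) n = M.cumRelEnt v μ n := by
  have := M.isProbabilityMeasure_dist hX hμ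
  have hmem' : ∀ i z, v i z ∈ M.meanSpace := fun i z => hab (hmem i z)
  obtain ⟨C, hC⟩ := isCompact_Icc.exists_bound_of_continuousOn
    (continuousOn_const.sub ((M.continuousOn_tilt hX).mono hab) :
      ContinuousOn (fun y => M.tilt μ - M.tilt y) (Set.Icc a b))
  obtain ⟨D, hD⟩ := isCompact_Icc.exists_bound_of_continuousOn
    ((M.continuousOn_relEnt hX μ).mono hab)
  have hint : Integrable (M.logRatio v μ n) (iidLaw (M.dist μ) n) := by
    refine Integrable.mono' (g := fun z => ∑ i : Fin n, (C * |X (z i) - μ| + D)) ?_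
      (M.measurable_logRatio hX hv hmem' μ n).aestronglyMeasurable (ae_of_all _ fun z => ?_)
    · refine integrable_finsetSum _ fun i _ => ?_
      exact integrable_comp_eval (μ := fun _ : Fin n => M.dist μ)
        (f := fun x => C * |X x - μ| + D)
        ((((M.integrable_dist hX hμ).sub (integrable_const μ)).abs.const_mul C).add
          (integrable_const D))
    · rw [logRatio, transformSum]
      refine (norm_sum_le _ _).trans (Finset.sum_le_sum fun i _ => ?_)
      refine (norm_add_le _ _).trans (add_le_add ?_ (hD _ (hmem _ _)))
      rw [norm_mul]
      exact mul_le_mul_of_nonneg_right (hC _ (hmem _ _)) (norm_nonneg _)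
  exact ⟨hint, (M.integrable_logRatio hX hv hmem' hμ (M.integrable_dist hX hμ)
    (M.integral_dist hX hμ) n hint.lintegral_lt_top.ne).2.2⟩

/-- Chebyshev's inequality for the sum of `n` independent values of `X`. -/
lemma one_sub_le_iidLaw_real (hX : Measurable X) {μ : ℝ} (hμ : μ ∈ M.meanSpace) {n : ℕ}
    (hn : 0 < n) {w : ℝ} (hw : 0 < w) :
    1 - M.varX μ / (n * w ^ 2) ≤
      (iidLaw (M.dist μ) n).real {z | |∑ i, X (z i) - n * μ| < n * w} := by
  have := M.isProbabilityMeasure_dist hX hμ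
  have hn' : (0 : ℝ) < n := by exact_mod_cast hn
  have hL : MemLp (fun z : Fin n → Z => ∑ i, X (z i)) 2 (iidLaw (M.dist μ) n) :=
    memLp_finsetSum _ fun i _ =>
      (M.memLp_dist hX hμ).comp_measurePreserving (measurePreserving_eval _ i)
  have hE : ∫ z : Fin n → Z, ∑ i, X (z i) ∂iidLaw (M.dist μ) n = n * μ := by
    rw [iidLaw, integral_finsetSum _ fun i _ => integrable_comp_eval
      (μ := fun _ : Fin n => M.dist μ) (f := X) (M.integrable_dist hX hμ)]
    have h (i : Fin n) : ∫ z : Fin n → Z, X (z i) ∂Measure.pi (fun _ => M.dist μ) = μ := by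
      rw [integral_comp_eval (μ := fun _ : Fin n => M.dist μ) hX.aestronglyMeasurable,
        M.integral_dist hX hμ]
    simp [h]
  have hV : variance (fun z : Fin n → Z => ∑ i, X (z i)) (iidLaw (M.dist μ) n) = n * M.varX μ := by
    have h := variance_sum_pi (μ := fun _ : Fin n => M.dist μ) (X := fun _ => X)
      fun _ => M.memLp_dist hX hμ
    have h' : (∑ i : Fin n, fun ω : Fin n → Z => X (ω i)) = fun z => ∑ i, X (z i) := by
      ext z
      simp
    rw [h'] at h
    rw [iidLaw, h]
    simp [varX]
  have hc := meas_ge_le_variance_div_sq hL (c := n * w) (by positivity)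
  have hm : MeasurableSet {z : Fin n → Z | |∑ i, X (z i) - n * μ| < n * w} :=
    measurableSet_lt (by fun_prop) measurable_const
  have hcompl : {z : Fin n → Z | |∑ i, X (z i) - n * μ| < n * w}ᶜ =
      {z | n * w ≤ |∑ i, X (z i) - n * μ|} := by
    ext z
    simp
  rw [hE, hV, ← hcompl] at hc
  have h1 : (iidLaw (M.dist μ) n).real {z | |∑ i, X (z i) - n * μ| < n * w}ᶜ ≤
      M.varX μ / (n * w ^ 2) := by
    have h2 : n * M.varX μ / (n * w) ^ 2 = M.varX μ / (n * w ^ 2) := by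
      field_simp
    rw [← h2]
    exact ENNReal.toReal_le_of_le_ofReal
      (div_nonneg (mul_nonneg hn'.le (M.varX_pos hX hμ).le) (sq_nonneg _)) hc
  rw [probReal_compl_eq_one_sub hm] at h1
  linarith

/-- Few means can be predicted well: the predictive distribution gives each mean `μ` of small
cumulative divergence a substantial probability of sample averages within `w` of `μ`, but its
integral over all `μ` of this probability is only `2 w`. -/
lemma volume_cumRelEnt_le (hX : Measurable X) (hv : ∀ i, Measurable (v i)) {a b : ℝ}
    (hab : Set.Icc a b ⊆ M.meanSpace) (hmem : ∀ i z, v i z ∈ Set.Icc a b) {V : ℝ}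
    (hV : ∀ μ ∈ Set.Icc a b, M.varX μ ≤ V) {n : ℕ} (hn : 0 < n) {w : ℝ} (hw : 0 < w) {α β s : ℝ}
    (hα : 0 ≤ 1 + α) (hs : 0 < s) (hsle : s ≤ (1 + α) * (1 - V / (n * w ^ 2)) - β - 1) :
    volume {μ ∈ Set.Icc a b | M.cumRelEnt v μ n ≤ β} ≤
      ENNReal.ofReal (2 * w * Real.exp α / s) := by
  rcases Set.eq_empty_or_nonempty (Set.Icc a b) with hemp | ⟨μ₀, hμ₀⟩
  · simp [hemp]
  have hn' : (0 : ℝ) < n := by exact_mod_cast hn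
  have hmem' : ∀ i z, v i z ∈ M.meanSpace := fun i z => hab (hmem i z)
  have hprob := M.isProbabilityMeasure_predictiveLaw hX hv hmem' (hab hμ₀) n
  set Q := M.predictiveLaw v μ₀ n with hQ
  set T : Set (ℝ × (Fin n → Z)) := {p | |∑ i, X (p.2 i) - n * p.1| < n * w} with hT
  have hTm : MeasurableSet T := measurableSet_lt (by fun_prop) measurable_const
  have hlow : ∀ μ ∈ {μ ∈ Set.Icc a b | M.cumRelEnt v μ n ≤ β},
      ENNReal.ofReal (Real.exp (-α) * s) ≤ Q (Prod.mk μ ⁻¹' T) := by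
    rintro μ ⟨hμ, hβ⟩
    have := M.isProbabilityMeasure_dist hX (hab hμ)
    obtain ⟨hi, hie⟩ := M.integrable_logRatio_of_mem_Icc hX hv hab hmem (hab hμ) n
    have hsm : MeasurableSet (Prod.mk μ ⁻¹' T) := measurable_prodMk_left hTm
    have hone := M.lintegral_exp_neg_logRatio hX hv hmem' (hab hμ) n
    have hem : Measurable fun z => Real.exp (-M.logRatio v μ n z) :=
      (M.measurable_logRatio hX hv hmem' μ n).neg.exp
    have hei : Integrable (fun z => Real.exp (-M.logRatio v μ n z)) (iidLaw (M.dist μ) n) :=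
      (lintegral_ofReal_ne_top_iff_integrable hem.aestronglyMeasurable
        (ae_of_all _ fun z => (Real.exp_pos _).le)).1 (by simp [hone])
    have he1 : ∫ z, Real.exp (-M.logRatio v μ n z) ∂iidLaw (M.dist μ) n = 1 := by
      rw [integral_eq_lintegral_of_nonneg_ae (ae_of_all _ fun z => (Real.exp_pos _).le)
        hem.aestronglyMeasurable, hone, ENNReal.toReal_one]
    have hmain := exp_neg_mul_le_setIntegral_exp_neg hi hei he1.le (hie.trans_le hβ) hsm α
    have hcheb := M.one_sub_le_iidLaw_real hX (hab hμ) hn hw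
    have hQμ : Q (Prod.mk μ ⁻¹' T) = ENNReal.ofReal
        (∫ z in Prod.mk μ ⁻¹' T, Real.exp (-M.logRatio v μ n z) ∂iidLaw (M.dist μ) n) := by
      rw [hQ, M.predictiveLaw_congr hX hv hmem' (hab hμ₀) (hab hμ) n, predictiveLaw,
        withDensity_apply _ hsm, ofReal_integral_eq_lintegral_ofReal hei.integrableOn
          (ae_of_all _ fun z => (Real.exp_pos _).le)]
    rw [hQμ]
    refine ENNReal.ofReal_le_ofReal (le_trans ?_ hmain)
    refine mul_le_mul_of_nonneg_left ?_ (Real.exp_pos _).le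
    have h1 : 1 - V / (n * w ^ 2) ≤ (iidLaw (M.dist μ) n).real (Prod.mk μ ⁻¹' T) := by
      refine le_trans ?_ hcheb
      have := hV μ hμ
      gcongr
    have h2 := mul_le_mul_of_nonneg_left h1 hα
    linarith
  have hTot : ∫⁻ μ, Q (Prod.mk μ ⁻¹' T) = ENNReal.ofReal (2 * w) := by
    rw [← Measure.prod_apply hTm, Measure.prod_apply_symm hTm]
    have hsec (z : Fin n → Z) : (fun μ => (μ, z)) ⁻¹' T = Metric.ball ((∑ i, X (z i)) / n) w := by
      ext μ
      rw [Metric.mem_ball, Real.dist_eq, abs_sub_comm, Set.mem_preimage, hT]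
      have : (∑ i, X (z i)) - n * μ = n * ((∑ i, X (z i)) / n - μ) := by
        field_simp
      change |∑ i, X (z i) - n * μ| < n * w ↔ _
      rw [this, abs_mul, abs_of_pos hn', mul_lt_mul_iff_right₀ hn']
    simp [hsec, Real.volume_ball]
  have hpos : 0 < Real.exp (-α) * s := mul_pos (Real.exp_pos _) hs
  have hmark := mul_meas_ge_le_lintegral (μ := volume) (measurable_measure_prodMk_left hTm)
    (f := fun μ => Q (Prod.mk μ ⁻¹' T)) (ENNReal.ofReal (Real.exp (-α) * s))
  rw [hTot] at hmark
  have h3 : 2 * w * Real.exp α / s = 2 * w / (Real.exp (-α) * s) := by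
    rw [Real.exp_neg]
    field_simp
  rw [h3, ENNReal.ofReal_div_of_pos hpos, ENNReal.le_div_iff_mul_le
    (Or.inl (by simpa using hpos)) (Or.inl ENNReal.ofReal_ne_top), mul_comm]
  refine le_trans ?_ hmark
  exact mul_le_mul_right (measure_mono hlow) _

end ExpFamily

/-! ### The logarithmic lower bound for almost every mean -/

namespace ExpFamily

variable {Z : Type*} [MeasurableSpace Z] {ν : Measure Z} {X : Z → ℝ} (M : ExpFamily ν X)
  {v : (i : ℕ) → (Fin i → Z) → ℝ}

lemma eventually_volume_cumRelEnt_le (hX : Measurable X) (hv : ∀ i, Measurable (v i)) {a b : ℝ}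
    (hab : Set.Icc a b ⊆ M.meanSpace) (hmem : ∀ i z, v i z ∈ Set.Icc a b) {δ : ℝ} (hδ : 0 < δ)
    (hδ' : δ ≤ 1 / 10) :
    ∀ᶠ n : ℕ in atTop,
      volume {μ ∈ Set.Icc a b | M.cumRelEnt v μ n ≤ (1 / 2 - 4 * δ) * Real.log n} ≤
        ENNReal.ofReal (2 * (n : ℝ) ^ (-δ)) := by
  obtain ⟨V, hV⟩ := isCompact_Icc.exists_bound_of_continuousOn (f := M.varX) (s := Set.Icc a b)
    fun μ hμ => (M.continuousAt_varX hX (hab hμ)).continuousWithinAt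
  have hlog : Tendsto (fun n : ℕ => Real.log n) atTop atTop :=
    Real.tendsto_log_atTop.comp tendsto_natCast_atTop_atTop
  have hpow : Tendsto (fun n : ℕ => V * (n : ℝ) ^ (-(2 * δ))) atTop (𝓝 0) := by
    simpa using ((tendsto_rpow_neg_atTop (by positivity : 0 < 2 * δ)).comp
      tendsto_natCast_atTop_atTop).const_mul V
  filter_upwards [hlog.eventually_ge_atTop ((1 + δ) / δ), hpow.eventually_le_const hδ,
    eventually_gt_atTop 0] with n hL hVn hn
  have hn' : (0 : ℝ) < n := by exact_mod_cast hn
  set l := Real.log n with hl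
  rw [div_le_iff₀ hδ] at hL
  have hl0 : 0 < l := by
    by_contra! h
    nlinarith
  -- The window is wider than the fluctuations `n ^ (-1/2)` of the sample mean, but narrower than
  -- `exp (-α)`, the factor by which the predictive distribution may lose.
  have hmain := M.volume_cumRelEnt_le hX hv hab hmem
    (fun μ hμ => (le_abs_self _).trans (hV μ hμ)) hn
    (w := (n : ℝ) ^ (δ - 1 / 2)) (by positivity) (α := (1 / 2 - 2 * δ) * l)
    (β := (1 / 2 - 4 * δ) * l) (s := 1) (by nlinarith) one_pos ?_
  · refine hmain.trans (le_of_eq ?_)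
    have h1 : Real.exp ((1 / 2 - 2 * δ) * l) = (n : ℝ) ^ (1 / 2 - 2 * δ) := by
      rw [Real.rpow_def_of_pos hn', mul_comm]
    rw [h1, div_one, mul_assoc, ← Real.rpow_add hn']
    ring_nf
  · have h2 : V / (n * ((n : ℝ) ^ (δ - 1 / 2)) ^ 2) = V * (n : ℝ) ^ (-(2 * δ)) := by
      rw [show -(2 * δ) = -(1 + (δ - 1 / 2) * (2 : ℕ)) by push_cast; ring, Real.rpow_neg hn'.le,
        Real.rpow_add hn', Real.rpow_one, Real.rpow_mul hn'.le, Real.rpow_natCast, div_eq_mul_inv]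
    rw [h2]
    have h3 : (1 + (1 / 2 - 2 * δ) * l) * (V * (n : ℝ) ^ (-(2 * δ))) ≤
        (1 + (1 / 2 - 2 * δ) * l) * δ :=
      mul_le_mul_of_nonneg_left hVn (by nlinarith)
    nlinarith [mul_pos hδ hl0, mul_pos hδ (mul_pos hδ hl0)]

/-- Sequential predictions with means in a compact interval have an expected cumulative divergence
of at least `κ ln n`, for each `κ < 1 / 2` and almost every true mean. The exceptional means are
controlled along `n = 2 ^ k` by the Borel-Cantelli lemma, and monotonicity in `n` fills the gaps. -/
theorem ae_eventually_mul_log_le_cumRelEnt (hX : Measurable X) (hv : ∀ i, Measurable (v i))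
    {a b : ℝ} (hab : Set.Icc a b ⊆ M.meanSpace) (hmem : ∀ i z, v i z ∈ Set.Icc a b) {κ : ℝ}
    (hκ0 : 0 ≤ κ) (hκ : κ < 1 / 2) :
    ∀ᵐ μ : ℝ, μ ∈ Set.Icc a b → ∀ᶠ n : ℕ in atTop, κ * Real.log n ≤ M.cumRelEnt v μ n := by
  obtain ⟨δ, hδ⟩ : ∃ δ, δ = (1 / 2 - κ) / 5 := ⟨_, rfl⟩
  have hδ0 : 0 < δ := by rw [hδ]; linarith
  have hκδ : κ = 1 / 2 - 5 * δ := by rw [hδ]; ring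
  have hev := (tendsto_pow_atTop_atTop_of_one_lt (one_lt_two : (1 : ℕ) < 2)).eventually
    (M.eventually_volume_cumRelEnt_le hX hv hab hmem hδ0 (by linarith))
  obtain ⟨K, hK⟩ := eventually_atTop.1 hev
  set S : ℕ → Set ℝ := fun k => {μ ∈ Set.Icc a b |
    M.cumRelEnt v μ (2 ^ k) ≤ (1 / 2 - 4 * δ) * Real.log (2 ^ k : ℕ)} with hS
  have hr : (2 : ℝ) ^ (-δ) < 1 := Real.rpow_lt_one_of_one_lt_of_neg one_lt_two (by linarith)
  have hr0 : 0 ≤ (2 : ℝ) ^ (-δ) := by positivity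
  have hsum : ∑' k, volume (S (k + K)) ≠ ∞ := by
    have h1 (k : ℕ) : volume (S (k + K)) ≤ ENNReal.ofReal (2 * ((2 : ℝ) ^ (-δ)) ^ (k + K)) := by
      refine (hK (k + K) (by omega)).trans (le_of_eq ?_)
      congr 2
      push_cast
      rw [← Real.rpow_natCast, ← Real.rpow_natCast, ← Real.rpow_mul zero_le_two,
        ← Real.rpow_mul zero_le_two, mul_comm]
    refine ne_top_of_le_ne_top ?_ (ENNReal.tsum_le_tsum h1)
    refine Summable.tsum_ofReal_ne_top ?_
    exact ((summable_nat_add_iff K).2 (summable_geometric_of_lt_one hr0 hr)).mul_left 2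
  filter_upwards [ae_eventually_notMem hsum] with μ hμS hμ
  obtain ⟨K', hK'⟩ := eventually_atTop.1 hμS
  obtain ⟨N, hN⟩ := exists_nat_ge (1 / (2 * δ))
  filter_upwards [eventually_ge_atTop (2 ^ (K + K' + N)), eventually_gt_atTop 0] with n hn2 hn0
  have hn := Nat.le_log_of_pow_le one_lt_two hn2
  set k := Nat.log 2 n with hk
  have hkS : μ ∉ S k := by
    have := hK' (k - K) (by omega)
    rwa [Nat.sub_add_cancel (by omega)] at this
  have hlow : (1 / 2 - 4 * δ) * Real.log (2 ^ k : ℕ) < M.cumRelEnt v μ (2 ^ k) := by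
    by_contra! h
    exact hkS ⟨hμ, h⟩
  have hmono := M.monotone_cumRelEnt hX (fun i z => hab (hmem i z)) (hab hμ)
    (Nat.pow_log_le_self 2 hn0.ne')
  refine le_trans ?_ (hlow.le.trans hmono)
  have hnk : Real.log n ≤ (k + 1) * Real.log 2 := by
    have h1 : (n : ℝ) ≤ 2 ^ (k + 1) := by
      exact_mod_cast (Nat.lt_pow_succ_log_self one_lt_two n).le
    have h2 := Real.log_le_log (by exact_mod_cast hn0) h1
    rw [Real.log_pow] at h2
    exact_mod_cast h2
  have hNk : 1 / (2 * δ) ≤ k := hN.trans (by exact_mod_cast (by omega : N ≤ k))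
  rw [div_le_iff₀ (by positivity)] at hNk
  calc κ * Real.log n ≤ κ * ((k + 1) * Real.log 2) := mul_le_mul_of_nonneg_left hnk hκ0
    _ = κ * (k + 1) * Real.log 2 := by ring
    _ ≤ (1 / 2 - 4 * δ) * k * Real.log 2 := by
      refine mul_le_mul_of_nonneg_right ?_ (Real.log_nonneg one_le_two)
      rw [hκδ]
      nlinarith
    _ = (1 / 2 - 4 * δ) * Real.log (2 ^ k : ℕ) := by
      push_cast
      rw [Real.log_pow]
      ring

end ExpFamily

/-! ### Extended-real expectations -/

lemma coe_finsetSum_ereal {ι : Type*} (s : Finset ι) (f : ι → ℝ) :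
    ((∑ i ∈ s, f i : ℝ) : EReal) = ∑ i ∈ s, (f i : EReal) :=
  map_sum (⟨⟨Real.toEReal, EReal.coe_zero⟩, EReal.coe_add⟩ : ℝ →+ EReal) f s

section Expectation

variable {Ω : Type*} [MeasurableSpace Ω] {Q : Measure Ω}

lemma expectation_congr_ae {f g : Ω → EReal} (h : f =ᵐ[Q] g) : expectation Q f = expectation Q g := by
  have h1 : ∫⁻ ω, (f ω).toENNReal ∂Q = ∫⁻ ω, (g ω).toENNReal ∂Q :=
    lintegral_congr_ae (h.mono fun ω hω => by simp only [hω])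
  have h2 : ∫⁻ ω, (-f ω).toENNReal ∂Q = ∫⁻ ω, (-g ω).toENNReal ∂Q :=
    lintegral_congr_ae (h.mono fun ω hω => by simp only [hω])
  rw [expectation, expectation, h1, h2]

lemma expectation_coe_of_integrable {f : Ω → ℝ} (hf : Integrable f Q) :
    expectation Q (fun ω => (f ω : EReal)) = ((∫ ω, f ω ∂Q : ℝ) : EReal) := by
  have h1 : ∫⁻ ω, ENNReal.ofReal (f ω) ∂Q ≠ ∞ := hf.lintegral_lt_top.ne
  have h2 : ∫⁻ ω, ENNReal.ofReal (-f ω) ∂Q ≠ ∞ := hf.neg.lintegral_lt_top.ne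
  rw [expectation, if_neg (by simpa only [EReal.real_coe_toENNReal] using h1)]
  simp only [← EReal.coe_neg, EReal.real_coe_toENNReal]
  rw [integral_eq_lintegral_pos_part_sub_lintegral_neg_part hf, EReal.coe_sub,
    EReal.coe_ennreal_toReal h1, EReal.coe_ennreal_toReal h2]

lemma expectation_coe_eq_top {f : Ω → ℝ} (h : ∫⁻ ω, ENNReal.ofReal (f ω) ∂Q = ∞) :
    expectation Q (fun ω => (f ω : EReal)) = ⊤ := by
  simp [expectation, h]

end Expectation

/-! ### Redundancy as cumulative divergence -/

namespace ExpFamily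

variable {Z : Type*} [MeasurableSpace Z] {ν ρ : Measure Z} {X : Z → ℝ} (M : ExpFamily ν X)

/-- The real value of the log loss `-ln M_μ(z)` at outcomes `z` with positive density; junk where
the carrier vanishes. -/
noncomputable def realLoss (μ : ℝ) (z : Z) : ℝ :=
  cgf X M.base (M.tilt μ) - M.tilt μ * X z - Real.log (M.h z)

lemma measurable_realLoss (hX : Measurable X) (μ : ℝ) : Measurable (M.realLoss μ) := by
  have := M.measurable_h
  unfold realLoss
  fun_prop

lemma realLoss_eq_add (μ v : ℝ) (z : Z) :
    M.realLoss v z =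
      M.realLoss μ z + ((M.tilt μ - M.tilt v) * (X z - μ) + M.relEnt μ v) := by
  rw [realLoss, realLoss, relEnt]
  ring

lemma density_eq (hX : Measurable X) {μ : ℝ} (hμ : μ ∈ M.meanSpace) (z : Z) :
    M.density μ z = (M.h z : ℝ≥0∞) *
      ENNReal.ofReal (Real.exp (M.tilt μ * X z - cgf X M.base (M.tilt μ))) := by
  rw [← M.natDensity_eq hX (M.tilt_mem hX hμ), density, tilt, neg_neg]

lemma logLoss_eq_coe (hX : Measurable X) {μ : ℝ} (hμ : μ ∈ M.meanSpace) {z : Z}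
    (hz : M.h z ≠ 0) : M.logLoss μ z = (M.realLoss μ z : EReal) := by
  have hz' : (0 : ℝ) < M.h z := NNReal.coe_pos.2 (pos_iff_ne_zero.2 hz)
  rw [logLoss, M.density_eq hX hμ, ← ENNReal.ofReal_coe_nnreal, ← ENNReal.ofReal_mul hz'.le,
    ENNReal.log_ofReal_of_pos (mul_pos hz' (Real.exp_pos _)),
    Real.log_mul hz'.ne' (Real.exp_pos _).ne', Real.log_exp, ← EReal.coe_neg, realLoss]
  congr 1
  ring

lemma logLoss_eq_top (hX : Measurable X) {μ : ℝ} (hμ : μ ∈ M.meanSpace) {z : Z}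
    (hz : M.h z = 0) : M.logLoss μ z = ⊤ := by
  simp [logLoss, M.density_eq hX hμ, hz]

lemma ae_h_ne_zero (hX : Measurable X) {μ : ℝ} (hμ : μ ∈ M.meanSpace) {Q : Measure Z}
    (h : expectation Q (M.logLoss μ) ≠ ⊤) : ∀ᵐ z ∂Q, M.h z ≠ 0 := by
  have h1 : ∫⁻ z, (M.logLoss μ z).toENNReal ∂Q ≠ ∞ := fun h1 => h (by simp [expectation, h1])
  have h2 : MeasurableSet {z | M.h z = 0} := M.measurable_h (measurableSet_singleton 0)
  have h3 : ∫⁻ z in {z | M.h z = 0}, (M.logLoss μ z).toENNReal ∂Q ≠ ∞ :=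
    ne_top_of_le_ne_top h1 (setLIntegral_le_lintegral _ _)
  rw [setLIntegral_congr_fun (g := fun _ => ∞) h2
    (fun z hz => by simp [M.logLoss_eq_top hX hμ hz])] at h3
  rw [ae_iff]
  simp only [ne_eq, not_not]
  by_contra h4
  simp [ENNReal.top_mul, h4] at h3

lemma integrable_realLoss (hX : Measurable X) {μ : ℝ} (hμ : μ ∈ M.meanSpace) {Q : Measure Z}
    (h : expectation Q (M.logLoss μ) ≠ ⊤ ∧ expectation Q (M.logLoss μ) ≠ ⊥) :
    Integrable (M.realLoss μ) Q := by
  have hae := M.ae_h_ne_zero hX hμ h.1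
  have hcoe : M.logLoss μ =ᵐ[Q] fun z => (M.realLoss μ z : EReal) :=
    hae.mono fun z hz => M.logLoss_eq_coe hX hμ hz
  rw [expectation_congr_ae hcoe] at h
  have hm := M.measurable_realLoss hX μ
  have h1 : ∫⁻ z, ENNReal.ofReal (M.realLoss μ z) ∂Q ≠ ∞ := fun h1 =>
    h.1 (expectation_coe_eq_top h1)
  have h2 : ∫⁻ z, ENNReal.ofReal (-M.realLoss μ z) ∂Q ≠ ∞ := fun h2 => by
    refine h.2 ?_
    rw [expectation, if_neg (by simpa only [EReal.real_coe_toENNReal] using h1)]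
    simp only [← EReal.coe_neg, EReal.real_coe_toENNReal, h2]
    rw [EReal.coe_ennreal_top, EReal.sub_top]
  refine ⟨hm.aestronglyMeasurable, ?_⟩
  rw [hasFiniteIntegral_iff_norm]
  have h3 (z : Z) : ENNReal.ofReal ‖M.realLoss μ z‖ =
      ENNReal.ofReal (M.realLoss μ z) + ENNReal.ofReal (-M.realLoss μ z) := by
    rcases le_total 0 (M.realLoss μ z) with h | h
    · rw [Real.norm_of_nonneg h, ENNReal.ofReal_of_nonpos (neg_nonpos.2 h), add_zero]
    · rw [Real.norm_of_nonpos h, ENNReal.ofReal_of_nonpos h, zero_add]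
  simp only [h3]
  rw [lintegral_add_left hm.ennreal_ofReal]
  exact ENNReal.add_lt_top.2 ⟨h1.lt_top, h2.lt_top⟩

end ExpFamily

namespace PlugInModel

variable {Z : Type*} [MeasurableSpace Z] {ν ρ : Measure Z} {X : Z → ℝ} {M : ExpFamily ν X}
  (U : PlugInModel M)

lemma codelength_eq_coe (hX : Measurable X) (μ : ℝ) (n : ℕ) {z : Fin n → Z}
    (hz : ∀ i, M.h (z i) ≠ 0) :
    U.codelength n z = ((∑ i, M.realLoss μ (z i) + M.logRatio U.est μ n z : ℝ) : EReal) := by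
  rw [ExpFamily.logRatio, transformSum, ← Finset.sum_add_distrib, codelength, coe_finsetSum_ereal]
  refine Finset.sum_congr rfl fun i _ => ?_
  rw [← M.realLoss_eq_add, M.logLoss_eq_coe hX (U.est_mem _ _) (hz i)]

/-- For outcomes under which `X` has mean `μ`, the redundancy is infinite or at least the expected
cumulative divergence of the estimates from `μ`. -/
theorem redundancy_eq_top_or_le (hX : Measurable X) {μ : ℝ} (hμ : μ ∈ M.meanSpace) {Q : Measure Z}
    [IsProbabilityMeasure Q] (hQ : Integrable X Q) (hQμ : ∫ z, X z ∂Q = μ)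
    (h : expectation Q (M.logLoss μ) ≠ ⊤ ∧ expectation Q (M.logLoss μ) ≠ ⊥) (n : ℕ) :
    U.redundancy Q n = ⊤ ∨
      (∀ i < n, Integrable (fun z => M.relEnt μ (U.est i z)) (iidLaw Q i)) ∧
        ((∑ i ∈ Finset.range n, ∫ z, M.relEnt μ (U.est i z) ∂iidLaw Q i : ℝ) : EReal) ≤
          U.redundancy Q n := by
  set A : (Fin n → Z) → ℝ := fun z => ∑ i, M.realLoss μ (z i) with hA
  have hAi : Integrable A (iidLaw Q n) := integrable_finsetSum _ fun i _ =>
    integrable_comp_eval (μ := fun _ : Fin n => Q) (M.integrable_realLoss hX hμ h)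
  have hae : ∀ᵐ z ∂iidLaw Q n, ∀ i, M.h (z i) ≠ 0 := ae_all_iff.2 fun i =>
    (measurePreserving_eval (fun _ : Fin n => Q) i).quasiMeasurePreserving.ae
      (M.ae_h_ne_zero hX hμ h.1)
  have hinf : ⨅ μ ∈ M.meanSpace, expectation (iidLaw Q n) (fun z => ∑ i, M.logLoss μ (z i)) ≤
      ((∫ z, A z ∂iidLaw Q n : ℝ) : EReal) := by
    refine (iInf₂_le μ hμ).trans (le_of_eq ?_)
    rw [← expectation_coe_of_integrable hAi]
    refine expectation_congr_ae (hae.mono fun z hz => ?_)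
    simp only [hA, coe_finsetSum_ereal]
    exact Finset.sum_congr rfl fun i _ => M.logLoss_eq_coe hX hμ (hz i)
  have hcode : expectation (iidLaw Q n) (U.codelength n) =
      expectation (iidLaw Q n) fun z => ((A z + M.logRatio U.est μ n z : ℝ) : EReal) :=
    expectation_congr_ae (hae.mono fun z hz => U.codelength_eq_coe hX μ n hz)
  rw [redundancy, hcode]
  by_cases hpos : ∫⁻ z, ENNReal.ofReal (A z + M.logRatio U.est μ n z) ∂iidLaw Q n = ∞
  · left
    rw [expectation_coe_eq_top hpos, sub_eq_add_neg]
    refine EReal.top_add_of_ne_bot ?_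
    rw [Ne, EReal.neg_eq_bot_iff]
    exact ne_top_of_le_ne_top (EReal.coe_ne_top _) hinf
  · right
    have hG : ∫⁻ z, ENNReal.ofReal (M.logRatio U.est μ n z) ∂iidLaw Q n ≠ ∞ := by
      have h1 : ∫⁻ z, (ENNReal.ofReal (A z + M.logRatio U.est μ n z) + ENNReal.ofReal (-A z))
          ∂iidLaw Q n ≠ ∞ := by
        rw [lintegral_add_right' (g := fun z => ENNReal.ofReal (-A z)) _
          hAi.1.aemeasurable.neg.ennreal_ofReal]
        exact ENNReal.add_ne_top.2 ⟨hpos, hAi.neg.lintegral_lt_top.ne⟩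
      refine ne_top_of_le_ne_top h1 (lintegral_mono fun z => ?_)
      refine le_trans (ENNReal.ofReal_le_ofReal (le_of_eq ?_)) ENNReal.ofReal_add_le
      ring
    obtain ⟨hGi, hdi, hGe⟩ :=
      M.integrable_logRatio hX U.measurable_est U.est_mem hμ hQ hQμ n hG
    refine ⟨hdi, ?_⟩
    have hsum : Integrable (fun z => A z + M.logRatio U.est μ n z) (iidLaw Q n) := hAi.add hGi
    rw [expectation_coe_of_integrable hsum, integral_add hAi hGi, hGe]
    refine le_trans (le_of_eq ?_) (EReal.sub_le_sub le_rfl hinf)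
    rw [← EReal.coe_sub]
    congr 1
    ring

/-- If the variances of `P` are at least `r` times those of `M` on an interval, then for outcomes
from `P_μ` with `μ` in this interval the redundancy with respect to `M` is at least `r` times the
cumulative divergence within `P` of the estimates truncated to the interval. -/
lemma mul_cumRelEnt_le_redundancy (hX : Measurable X) {P : ExpFamily ρ X}
    (hP : HasLargerVariance P M) {a b r : ℝ} (hab : a ≤ b) (hsub : Set.Icc a b ⊆ M.meanSpace)
    (hr0 : 0 ≤ r) (hr : ∀ x ∈ Set.Icc a b, r * M.varX x ≤ P.varX x) {μ : ℝ}
    (hμ : μ ∈ Set.Icc a b) (n : ℕ) :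
    ((r * P.cumRelEnt (fun i z => (Set.projIcc a b hab (U.est i z) : ℝ)) μ n : ℝ) : EReal) ≤
      U.redundancy (P.dist μ) n := by
  have hsubP : Set.Icc a b ⊆ P.meanSpace := hP.meanSpace_eq ▸ hsub
  have := P.isProbabilityMeasure_dist hX (hsubP hμ)
  rcases U.redundancy_eq_top_or_le hX (hsub hμ) (P.integrable_dist hX (hsubP hμ))
    (P.integral_dist hX (hsubP hμ)) (hP.logLoss_finite μ (hsub hμ)) n with h | ⟨hi, h⟩
  · rw [h]
    exact le_top
  refine le_trans (EReal.coe_le_coe_iff.2 ?_) h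
  rw [ExpFamily.cumRelEnt, Finset.mul_sum]
  refine Finset.sum_le_sum fun i hin => ?_
  rw [← integral_const_mul]
  refine integral_mono_of_nonneg (ae_of_all _ fun z => mul_nonneg hr0
    (P.relEnt_nonneg hX (hsubP hμ) (hsubP (Subtype.prop _)))) (hi i (Finset.mem_range.1 hin))
    (ae_of_all _ fun z => ?_)
  exact ExpFamily.mul_relEnt_projIcc_le M P hX hab hsub hsubP hr hμ (U.est_mem i z)

/-- For almost every mean, the redundancy eventually exceeds `s ln n` for each `s` below half the
ratio of the variances. Only countably many rational intervals and constants are needed, so the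
exceptional null sets can be combined. -/
theorem ae_eventually_mul_log_le_redundancy (hX : Measurable X) {P : ExpFamily ρ X}
    (hP : HasLargerVariance P M) :
    ∀ᵐ μ : ℝ, μ ∈ M.meanSpace → ∀ s < 1 / 2 * (P.varX μ / M.varX μ),
      ∀ᶠ n : ℕ in atTop, ((s * Real.log n : ℝ) : EReal) ≤ U.redundancy (P.dist μ) n := by
  have hq : ∀ᵐ μ : ℝ, ∀ a b r κ : ℚ, ((a : ℝ) ≤ b ∧ Set.Icc (a : ℝ) b ⊆ M.meanSpace ∧ (0 : ℝ) ≤ r ∧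
      (∀ x ∈ Set.Icc (a : ℝ) b, r * M.varX x ≤ P.varX x) ∧ (0 : ℝ) ≤ κ ∧ (κ : ℝ) < 1 / 2) →
      μ ∈ Set.Icc (a : ℝ) b → ∀ᶠ n : ℕ in atTop,
        ((r * (κ * Real.log n) : ℝ) : EReal) ≤ U.redundancy (P.dist μ) n := by
    simp only [ae_all_iff]
    rintro a b r κ ⟨hab, hsub, hr0, hr, hκ0, hκ⟩
    have hsubP : Set.Icc (a : ℝ) b ⊆ P.meanSpace := hP.meanSpace_eq ▸ hsub
    have hv (i : ℕ) : Measurable fun z => (Set.projIcc (a : ℝ) b hab (U.est i z) : ℝ) :=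
      measurable_subtype_coe.comp (continuous_projIcc.measurable.comp (U.measurable_est i))
    filter_upwards [P.ae_eventually_mul_log_le_cumRelEnt hX hv hsubP
      (fun i z => Subtype.prop _) hκ0 hκ] with μ h hμ
    filter_upwards [h hμ] with n hn
    refine le_trans (EReal.coe_le_coe_iff.2 (mul_le_mul_of_nonneg_left hn hr0)) ?_
    exact U.mul_cumRelEnt_le_redundancy hX hP hab hsub hr0 hr hμ n
  filter_upwards [hq] with μ hq hμ s hs
  have hμP : μ ∈ P.meanSpace := hP.meanSpace_eq ▸ hμ
  have hvM := M.varX_pos hX hμ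
  have hratio : 0 < P.varX μ / M.varX μ := div_pos (P.varX_pos hX hμP) hvM
  obtain ⟨κ, hκ1, hκ2⟩ := exists_rat_btwn
    (max_lt (by rw [div_lt_iff₀ hratio]; exact hs) one_half_pos :
      max (s / (P.varX μ / M.varX μ)) 0 < 1 / 2)
  rw [max_lt_iff, div_lt_iff₀ hratio] at hκ1
  obtain ⟨r, hr1, hr2⟩ := exists_rat_btwn
    (max_lt (by rw [div_lt_iff₀ hκ1.2, mul_comm]; exact hκ1.1) hratio :
      max (s / κ) 0 < P.varX μ / M.varX μ)
  rw [max_lt_iff, div_lt_iff₀ hκ1.2] at hr1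
  have hnear : ∀ᶠ x in 𝓝 μ, x ∈ M.meanSpace ∧ r * M.varX x < P.varX x := by
    refine Eventually.and ((M.isOpen_meanSpace hX).mem_nhds hμ) ?_
    refine (continuousAt_const.mul (M.continuousAt_varX hX hμ)).eventually_lt
      (P.continuousAt_varX hX hμP) ?_
    rwa [lt_div_iff₀ hvM] at hr2
  obtain ⟨l, u, ⟨hl, hu⟩, hlu⟩ := mem_nhds_iff_exists_Ioo_subset.1 hnear
  obtain ⟨a, ha1, ha2⟩ := exists_rat_btwn hl
  obtain ⟨b, hb1, hb2⟩ := exists_rat_btwn hu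
  have hIcc : Set.Icc (a : ℝ) b ⊆ Set.Ioo l u := Set.Icc_subset_Ioo ha1 hb2
  have hmain := hq a b r κ ⟨(ha2.trans hb1).le, fun x hx => (hlu (hIcc hx)).1, hr1.2.le,
    fun x hx => (hlu (hIcc hx)).2.le, hκ1.2.le, hκ2⟩ ⟨ha2.le, hb1.le⟩
  filter_upwards [hmain, eventually_ge_atTop 1] with n hn hn1
  refine le_trans (EReal.coe_le_coe_iff.2 ?_) hn
  rw [← mul_assoc]
  exact mul_le_mul_of_nonneg_right hr1.1.le (Real.log_nonneg (by exact_mod_cast hn1))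

end PlugInModel

theorem corollary1 {Z : Type*} [MeasurableSpace Z] (ν ρ : Measure Z) (X : Z → ℝ)
    (hX : Measurable X) (M : ExpFamily ν X)
    (hM : ∃ P : ExpFamily ρ X, HasLargerVariance P M) (U : PlugInModel M) :
    ∃ P : ExpFamily ρ X, HasLargerVariance P M ∧
      (∀ᵐ μ : ℝ, μ ∈ M.meanSpace →
        ((1 / 2 * (P.varX μ / M.varX μ) : ℝ) : EReal) ≤
            liminf (fun n : ℕ => U.redundancy (P.dist μ) n / ((Real.log n : ℝ) : EReal)) atTop ∧
          1 / 2 < 1 / 2 * (P.varX μ / M.varX μ)) ∧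
      volume {μ ∈ M.meanSpace | ∃ C : ℝ, ∀ᶠ n : ℕ in atTop,
        U.redundancy (P.dist μ) n ≤ ((1 / 2 * Real.log n + C : ℝ) : EReal)} = 0 := by
  obtain ⟨P, hP⟩ := hM
  have hlog : Tendsto (fun n : ℕ => Real.log n) atTop atTop :=
    Real.tendsto_log_atTop.comp tendsto_natCast_atTop_atTop
  have hgt {μ : ℝ} (hμ : μ ∈ M.meanSpace) : 1 / 2 < 1 / 2 * (P.varX μ / M.varX μ) := by
    have h1 : 1 < P.varX μ / M.varX μ := (one_lt_div (M.varX_pos hX hμ)).2 (hP.var_lt μ hμ)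
    linarith
  have hae := U.ae_eventually_mul_log_le_redundancy hX hP
  refine ⟨P, hP, ?_, ?_⟩
  · filter_upwards [hae] with μ h hμ
    refine ⟨EReal.ge_of_forall_gt_iff_ge.1 fun s hs => ?_, hgt hμ⟩
    refine le_liminf_of_le (by isBoundedDefault) ?_
    filter_upwards [h hμ s (EReal.coe_lt_coe_iff.1 hs), hlog.eventually_gt_atTop 0] with n hn hn0
    rw [EReal.le_div_iff_mul_le (by exact_mod_cast hn0) (EReal.coe_ne_top _), ← EReal.coe_mul]
    exact hn
  · refine measure_mono_null ?_ (ae_iff.1 hae)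
    rintro μ ⟨hμ, C, hC⟩ h
    obtain ⟨s, hs1, hs2⟩ := exists_between (hgt hμ)
    obtain ⟨n, hn1, hn2, hn3⟩ := ((h hμ s hs2).and (hC.and
      (hlog.eventually_gt_atTop (C / (s - 1 / 2))))).exists
    have h1 := EReal.coe_le_coe_iff.1 (hn1.trans hn2)
    rw [div_lt_iff₀ (by linarith)] at hn3
    nlinarith
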